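/- Let $T>0$, let $\mu:[0,1]\to\mathbb{R}_+$ be non-decreasing (hence bounded), let $\varphi=(\varphi_{m,l})_{m,l\in\{+,-\}}:\mathbb{R}_+\to\mathbb{R}^{2\times 2}$ be measurable, locally bounded and integrable with non-negative entries, and let $J$ be a positive random variable with law $\nu$ and $\mathbb{E}(J^2)<\infty$. Assume that $\rho(K)<1$, where $K=\mathbb{E}(J)\int_0^\infty|\varphi(u)|\,du$ and $\rho$ denotes the spectral radius. On a filtered probability space $(\Omega,\mathcal{F},(\mathcal{F}_t)_{t\ge 0},\mathbb{P})$ let $0<\tau_1<\tau_2<\dots$ be stopping times, almost surely only finitely many of them in $[0,T]$. Each $\tau_n$ carries a type in $\{+,-\}$ and a mark $J_n$, both $\mathcal{F}_{\tau_n}$-measurable, and $(J_n)_n$ is i.i.d. with law $\nu$. For $m\in\{+,-\}$ and a measurable function $h$, write $\int_0^t h(s)J_s\,dN^m_s=\sum_n J_n h(\tau_n)$, where the sum runs over the $n$ with $\tau_n\le t$ and $\tau_n$ of type $m$. Put $$\lambda^m_t=\mu\Big(\frac tT\Big)+\sum_{l\in\{+,-\}}\int_0^t\varphi_{m,l}(t-s)\,J_s\,dN^l_s,\qquad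 f^m_t=\int_0^tJ_s\,dN^m_s,\qquad t\in[0,T].$$ Assume that this is a bivariate marked Hawkes process on $[0,T]$: for each $m\in\{+,-\}$ the random measure on $[0,T]\times\mathbb{R}_+$ with atoms at the points $(\tau_n,J_n)$, $\tau_n$ of type $m$, has predictable compensator $\lambda^m_s\,ds\otimes\nu(dx)$. Let $a_+,a_-\in\mathbb{R}$. Then the equation $$C(t)=\mathbb{E}\left[\exp\left(iJ\begin{pmatrix}a_+\\a_-\end{pmatrix}+J\int_0^t\varphi(s)^{\top}\left(C(t-s)-\begin{pmatrix}1\\1\end{pmatrix}\right)ds\right)\right],\qquad t\in[0,T]$$ (the exponential being taken componentwise) has a bounded measurable solution $C=C(a_+,a_-,\cdot):[0,T]\to\mathbb{C}^2$ for which the exponentials are integrable. Moreover, for every such solution $C$ and every $t\in[0,T]$, $$\mathbb{E}\left(e^{ia_+f^+_t+ia_-f^-_t}\right)=\exp\left(\int_0^t\mu\Big(\frac sT\Big)\begin{pmatrix}1\\1\end{pmatrix}^{\top}\left(C(a_+,a_-,t-s)-\begin{pmatrix}1\\1\end{pmatrix}\right)ds\right).$$ -/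

import Mathlib

open MeasureTheory ProbabilityTheory Set
open scoped NNReal ENNReal

noncomputable section

namespace MarkedHawkes

/-- The raw data of a bivariate marked point process: the arrival times, the type of each arrival
(`0` stands for `+` and `1` stands for `-`) and the mark (jump size) of each arrival.
Only the arrivals in the time horizon `[0, T]` will matter. -/
structure MarkedPoints (Ω : Type*) where
  time : ℕ → Ω → ℝ≥0
  sign : ℕ → Ω → Fin 2
  mark : ℕ → Ω → ℝ

variable {Ω : Type*}

/-- The integral `∫_0^t h(s) J_s dN^m_s`, that is, the sum of `J_n * h(τ_n)` over the arrivals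
`τ_n ≤ t` of type `m`. -/
def MarkedPoints.integral (X : MarkedPoints Ω) (h : ℝ → ℝ) (m : Fin 2) (t : ℝ) (ω : Ω) : ℝ :=
  ∑' n, if (X.time n ω : ℝ) ≤ t ∧ X.sign n ω = m then X.mark n ω * h (X.time n ω) else 0

/-- The process `f^m_t = ∫_0^t J_s dN^m_s`. -/
def MarkedPoints.jumps (X : MarkedPoints Ω) (m : Fin 2) (t : ℝ) (ω : Ω) : ℝ :=
  X.integral (fun _ => 1) m t ω

/-- The process `λ^m_t = μ(t/T) + ∑_l ∫_0^t φ_{m,l}(t-s) J_s dN^l_s`. -/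
def MarkedPoints.intensity (X : MarkedPoints Ω) (T : ℝ) (μ : ℝ → ℝ)
    (φ : ℝ → Matrix (Fin 2) (Fin 2) ℝ) (m : Fin 2) (t : ℝ) (ω : Ω) : ℝ :=
  μ (t / T) + ∑ l, X.integral (fun s => φ (t - s) m l) l t ω

/-- `X` is, on the time horizon `[0, T]`, a bivariate marked Hawkes process for the filtration `𝓕`,
with baseline `μ(·/T)`, kernel `φ` and mark law `ν`. -/
structure IsMarkedHawkes {mΩ : MeasurableSpace Ω} (P : Measure Ω) (𝓕 : Filtration ℝ≥0 mΩ)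
    (T : ℝ) (μ : ℝ → ℝ) (φ : ℝ → Matrix (Fin 2) (Fin 2) ℝ) (ν : Measure ℝ)
    (X : MarkedPoints Ω) : Prop where
  time_pos : ∀ ω, 0 < X.time 0 ω
  time_strictMono : ∀ ω, StrictMono fun n => X.time n ω
  /-- There are almost surely finitely many arrivals up to the horizon. -/
  locallyFinite : ∀ᵐ ω ∂P, {n | (X.time n ω : ℝ) ≤ T}.Finite
  stopping : ∀ n, IsStoppingTime 𝓕 fun ω => (X.time n ω : WithTop ℝ≥0)
  sign_measurable : ∀ n, Measurable[(stopping n).measurableSpace] (X.sign n)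
  mark_measurable : ∀ n, Measurable[(stopping n).measurableSpace] (X.mark n)
  mark_law : ∀ n, P.map (X.mark n) = ν
  mark_indep : iIndepFun X.mark P
  /-- The random measure on `[0, T] × ℝ` which has an atom at `(τ_n, J_n)` for every arrival of
  type `m` has the predictable compensator `λ^m_s ds ⊗ ν(dx)`. -/
  compensator : ∀ (m : Fin 2) (H : (ℝ≥0 × Ω) × ℝ → ℝ≥0∞),
    Measurable[𝓕.predictable.prod inferInstance] H →
    ∫⁻ ω, ∑' n, (if (X.time n ω : ℝ) ≤ T ∧ X.sign n ω = m
        then H ((X.time n ω, ω), X.mark n ω) else 0) ∂P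
      = ∫⁻ ω, (∫⁻ s in Icc (0 : ℝ) T, (∫⁻ x, H ((s.toNNReal, ω), x) ∂ν) *
          ENNReal.ofReal (X.intensity T μ φ m s ω)) ∂P

/-- The `l`-th component of `exp(i x a + x ∫_0^t φ(s)ᵀ (C(t-s) - 1) ds)`, for a mark value `x`. -/
def markFactor (φ : ℝ → Matrix (Fin 2) (Fin 2) ℝ) (a : Fin 2 → ℝ) (C : ℝ → Fin 2 → ℂ)
    (l : Fin 2) (t x : ℝ) : ℂ :=
  Complex.exp (Complex.I * x * a l +
    x * ∫ s in (0 : ℝ)..t, ∑ m, (φ s m l : ℂ) * (C (t - s) m - 1))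

/-- `C` is a (measurable, bounded) solution on `[0, T]` of the fixed-point equation
`C(t) = E[exp(i J a + J ∫_0^t φ(s)ᵀ (C(t-s) - 1) ds)]`, where `J` has law `ν`. -/
structure IsSolution (T : ℝ) (φ : ℝ → Matrix (Fin 2) (Fin 2) ℝ) (ν : Measure ℝ)
    (a : Fin 2 → ℝ) (C : ℝ → Fin 2 → ℂ) : Prop where
  measurable : Measurable C
  bounded : ∃ B : ℝ, ∀ t ∈ Icc (0 : ℝ) T, ∀ m, ‖C t m‖ ≤ B
  integrable : ∀ t ∈ Icc (0 : ℝ) T, ∀ l, Integrable (markFactor φ a C l t) ν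
  eq : ∀ t ∈ Icc (0 : ℝ) T, ∀ l, C t l = ∫ x, markFactor φ a C l t x ∂ν

/-- The matrix `K = E(J) ∫_0^∞ |φ(u)| du`. -/
def branchingMatrix (φ : ℝ → Matrix (Fin 2) (Fin 2) ℝ) (ν : Measure ℝ) :
    Matrix (Fin 2) (Fin 2) ℝ :=
  fun i j => (∫ x, x ∂ν) * ∫ u in Ici (0 : ℝ), |φ u i j|

end MarkedHawkes

end

namespace MarkedHawkes

open Filter Topology

/-! ### Auxiliary analysis -/

/-! Fix a solution `C` and a time `t`, and put `d m u = C (t - u) m - 1`. For `s ≤ t` consider the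
exponential of `i (a₊ f⁺ + a₋ f⁻)` at time `s` plus the integral over `u` in `[s, t]` of `∑ m, rate
m u * d m u`, where the rate at `u` is the intensity produced by the arrivals up to `s` alone. At `s
= t` this is the variable whose mean is wanted. At `s = 0` it is deterministic and equals the
right-hand side of the formula. It remains to see that its mean does not change.

Between arrivals its derivative is minus the drift `∑ m, rate m * d m` times itself
(`IsAdmissible.pointExp_sub`). An arrival of type `l` at time `s` multiplies it by `jumpFactor`
(`IsAdmissible.pointExp_succ`), whose mean over the mark is `C (t - s) l = d l s + 1`; this is
exactly the fixed-point equation. The compensator of the jumps is therefore the drift times the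
process, and the two effects cancel in mean (`IsMarkedHawkes.integral_jump`). The cancellation is
proved for one interarrival interval at a time, with the compensator formula applied to integrands
supported there; finitely many arrivals and dominated convergence finish the proof.

Everything is bounded by 1 because marks are positive and `d` has nonpositive real part. This
requires the a priori estimate `IsSolution.norm_le_one`: every bounded solution lies in the closed
unit disc. Existence comes from Picard iteration in a sup norm with exponential weight in time. -/

/-- The half-plane is convex and the derivative of `exp` has norm at most 1 there. With this bound,
contraction estimates need only the first moment of the mark. -/
lemma norm_exp_sub_exp_le {z w : ℂ} (hz : z.re ≤ 0) (hw : w.re ≤ 0) :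
    ‖Complex.exp z - Complex.exp w‖ ≤ ‖z - w‖ := by
  have hconv : Convex ℝ {z : ℂ | z.re ≤ 0} := convex_halfSpace_re_le 0
  have := hconv.norm_image_sub_le_of_norm_deriv_le (𝕜 := ℂ) (f := Complex.exp) (C := 1)
    (x := w) (y := z) (fun x _ => Complex.differentiable_exp x) (fun x hx => by
      rw [Complex.deriv_exp, Complex.norm_exp]
      exact Real.exp_le_one_iff.2 hx) hw hz
  simpa using this

lemma intervalIntegrable_of_measurable_of_bound {E : Type*} [NormedAddCommGroup E]
    {f : ℝ → E} {a b K : ℝ} (hf : AEStronglyMeasurable f) (hab : a ≤ b)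
    (hK : ∀ s ∈ Icc a b, ‖f s‖ ≤ K) : IntervalIntegrable f volume a b := by
  rw [intervalIntegrable_iff_integrableOn_Ioc_of_le hab]
  refine Measure.integrableOn_of_bounded (M := K) (by simp) hf ?_
  exact (ae_restrict_iff' measurableSet_Ioc).2 (ae_of_all _ fun s hs => hK s (Ioc_subset_Icc_self hs))

/-- The exponential of a primitive of a bounded function. -/
lemma exp_integral_sub {q : ℝ → ℂ} {K : ℝ} (hq : Measurable q) (hK : ∀ u, ‖q u‖ ≤ K)
    (hre : ∀ u, (q u).re ≤ 0) {r s t : ℝ} (hrs : r ≤ s) (hst : s ≤ t) :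
    Complex.exp (∫ u in s..t, q u) - Complex.exp (∫ u in r..t, q u)
      = -∫ v in r..s, q v * Complex.exp (∫ u in v..t, q u) := by
  have hK0 : 0 ≤ K := (norm_nonneg _).trans (hK 0)
  have hint : ∀ x y, IntervalIntegrable q volume x y := fun x y => by
    rcases le_total x y with h | h
    · exact intervalIntegrable_of_measurable_of_bound hq.aestronglyMeasurable h fun s _ => hK s
    · exact (intervalIntegrable_of_measurable_of_bound hq.aestronglyMeasurable h
        fun s _ => hK s).symm
  set Q : ℝ → ℂ := fun x => ∫ u in x..t, q u with hQ
  have hQsub : ∀ x y, Q x - Q y = ∫ u in x..y, q u := fun x y => by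
    simp only [hQ]
    rw [← intervalIntegral.integral_add_adjacent_intervals (hint x y) (hint y t),
      add_sub_cancel_right]
  have hQlip : ∀ x y, ‖Q x - Q y‖ ≤ K * |x - y| := fun x y => by
    rw [hQsub, abs_sub_comm]
    exact intervalIntegral.norm_integral_le_of_norm_le_const fun u _ => hK u
  have hQcont : Continuous Q := by
    refine LipschitzWith.continuous (K := K.toNNReal) (LipschitzWith.of_dist_le_mul fun x y => ?_)
    rw [dist_eq_norm, Real.dist_eq, Real.coe_toNNReal _ hK0]
    exact hQlip x y
  have hQre : ∀ x ≤ t, (Q x).re ≤ 0 := fun x hx => by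
    have : (Q x).re = ∫ u in x..t, (q u).re := by
      simpa using (Complex.reCLM.intervalIntegral_comp_comm (hint x t)).symm
    rw [this]
    have := intervalIntegral.integral_nonneg (μ := volume) (f := fun u => -(q u).re) hx
      (fun u _ => by linarith [hre u])
    rw [intervalIntegral.integral_neg] at this
    linarith
  have hexp : ∀ x ≤ t, ‖Complex.exp (Q x)‖ ≤ 1 := fun x hx => by
    rw [Complex.norm_exp]
    exact Real.exp_le_one_iff.2 (hQre x hx)
  set p : ℝ → ℂ := fun v => q v * Complex.exp (Q v) with hp
  have hpm : Measurable p := hq.mul hQcont.measurable.cexp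
  have hpK : ∀ v ≤ t, ‖p v‖ ≤ K := fun v hv => by
    rw [hp, norm_mul]
    nlinarith [hK v, hexp v hv, norm_nonneg (q v), norm_nonneg (Complex.exp (Q v))]
  have hpint : ∀ x y, IntervalIntegrable p volume x y := fun x y =>
    (hint x y).mul_continuousOn (Complex.continuous_exp.comp hQcont).continuousOn
  have hploc : LocallyIntegrable p := by
    intro x
    refine ⟨Ioc (x - 1) (x + 1), Ioc_mem_nhds (by linarith) (by linarith), ?_⟩
    exact (intervalIntegrable_iff_integrableOn_Ioc_of_le (by linarith)).1 (hpint _ _)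
  have hqloc : LocallyIntegrable q := by
    intro x
    refine ⟨Ioc (x - 1) (x + 1), Ioc_mem_nhds (by linarith) (by linarith), ?_⟩
    exact (intervalIntegrable_iff_integrableOn_Ioc_of_le (by linarith)).1 (hint _ _)
  -- As `q` is only measurable, the fundamental theorem of calculus holds only almost everywhere.
  -- But `g` is Lipschitz, hence absolutely continuous, and its derivative vanishes almost
  -- everywhere, so it is constant.
  set g : ℝ → ℂ := fun x => Complex.exp (Q x) + ∫ v in r..x, p v with hg
  have hgac : AbsolutelyContinuousOnInterval g r s := by
    refine LipschitzOnWith.absolutelyContinuousOnInterval (K := (2 * K).toNNReal) ?_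
    rw [uIcc_of_le hrs]
    refine LipschitzOnWith.of_dist_le_mul fun x hx y hy => ?_
    rw [dist_eq_norm, Real.dist_eq, Real.coe_toNNReal _ (by positivity)]
    have h1 := (norm_exp_sub_exp_le (hQre x (hx.2.trans hst)) (hQre y (hy.2.trans hst))).trans
      (hQlip x y)
    have h2 : ‖(∫ v in r..x, p v) - ∫ v in r..y, p v‖ ≤ K * |x - y| := by
      rw [intervalIntegral.integral_interval_sub_left (hpint _ _) (hpint _ _)]
      refine intervalIntegral.norm_integral_le_of_norm_le_const fun u hu => hpK u ?_
      rw [uIoc, mem_Ioc] at hu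
      exact hu.2.trans (max_le (hy.2.trans hst) (hx.2.trans hst))
    have h3 : g x - g y = (Complex.exp (Q x) - Complex.exp (Q y))
        + ((∫ v in r..x, p v) - ∫ v in r..y, p v) := by simp only [hg]; ring
    rw [h3]
    refine (norm_add_le _ _).trans ?_
    linarith
  obtain ⟨c, hc⟩ := hgac.const_of_ae_hasDerivAt_zero (by
    filter_upwards [LocallyIntegrable.ae_hasDerivAt_integral hploc,
      LocallyIntegrable.ae_hasDerivAt_integral hqloc] with x h1 h2 _
    have h3 : HasDerivAt Q (-q x) x := by
      have : Q = fun x => -∫ u in t..x, q u := by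
        ext x; simp only [hQ]; rw [intervalIntegral.integral_symm]
      rw [this]
      exact (h2 t).neg
    convert! h3.cexp.add (h1 r) using 1
    simp only [hp]; ring)
  have e1 := hc r left_mem_uIcc
  have e2 := hc s right_mem_uIcc
  simp only [hg, intervalIntegral.integral_same, add_zero] at e1 e2
  rw [e1, ← e2]
  ring

/-- The gain `1 / κ` is what makes Volterra operators contract in the weight `exp (κ * s)`.
Measurability of `v` is not needed: the comparison only asks that the dominating function be
integrable. -/
lemma integral_le_of_le_exp {v : ℝ → ℝ} {A κ t : ℝ} (hκ : 0 < κ) (ht : 0 ≤ t) (hA : 0 ≤ A)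
    (hv0 : ∀ s ∈ Icc 0 t, 0 ≤ v s) (hv : ∀ s ∈ Icc 0 t, v s ≤ A * Real.exp (κ * s)) :
    ∫ s in (0 : ℝ)..t, v s ≤ A / κ * Real.exp (κ * t) := by
  have h1 : ∫ s in (0 : ℝ)..t, v s ≤ ∫ s in (0 : ℝ)..t, A * Real.exp (κ * s) := by
    rw [intervalIntegral.integral_of_le ht, intervalIntegral.integral_of_le ht]
    refine integral_mono_of_nonneg ?_ ?_ ?_
    · exact (ae_restrict_iff' measurableSet_Ioc).2
        (ae_of_all _ fun s hs => hv0 s (Ioc_subset_Icc_self hs))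
    · exact (intervalIntegrable_iff_integrableOn_Ioc_of_le ht).1
        (Continuous.intervalIntegrable (by fun_prop) _ _)
    · exact (ae_restrict_iff' measurableSet_Ioc).2
        (ae_of_all _ fun s hs => hv s (Ioc_subset_Icc_self hs))
  refine h1.trans ?_
  have h2 : ∫ s in (0 : ℝ)..t, A * Real.exp (κ * s)
      = A / κ * Real.exp (κ * t) - A / κ * Real.exp (κ * 0) := by
    refine intervalIntegral.integral_eq_sub_of_hasDerivAt (f := fun s => A / κ * Real.exp (κ * s))
      (fun s _ => ?_) (Continuous.intervalIntegrable (by fun_prop) _ _)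
    have := (((hasDerivAt_id s).const_mul κ).exp).const_mul (A / κ)
    convert! this using 1
    simp only [id, mul_one]
    field_simp
  rw [h2]
  have : 0 ≤ A / κ * Real.exp (κ * 0) := by positivity
  linarith

/-- A homogeneous Volterra inequality has only the trivial bounded solution. -/
lemma eq_zero_of_le_integral {v : ℝ → ℝ} {M L T : ℝ} (hv0 : ∀ s, 0 ≤ v s)
    (hM : ∀ s ∈ Icc 0 T, v s ≤ M)
    (hv : ∀ t ∈ Icc 0 T, v t ≤ L * ∫ s in (0 : ℝ)..t, v s) : ∀ t ∈ Icc 0 T, v t = 0 := by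
  intro t ht
  have hM0 : 0 ≤ M := (hv0 t).trans (hM t ht)
  -- With this weight, `|L| / κ ≤ 1 / 2`, so each use of the inequality halves the constant.
  set κ := 2 * |L| + 1
  have hκ : 0 < κ := by positivity
  have key : ∀ n : ℕ, ∀ s ∈ Icc 0 T, v s ≤ M * (1 / 2) ^ n * Real.exp (κ * s) := by
    intro n
    induction n with
    | zero =>
      intro s hs
      have : 1 ≤ Real.exp (κ * s) := Real.one_le_exp (mul_nonneg hκ.le hs.1)
      nlinarith [hM s hs]
    | succ n ih =>
      intro s hs
      have h1 := integral_le_of_le_exp (v := v) (A := M * (1 / 2) ^ n) hκ hs.1 (by positivity)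
        (fun u _ => hv0 u) fun u hu => ih u ⟨hu.1, hu.2.trans hs.2⟩
      have h0 : 0 ≤ ∫ u in (0 : ℝ)..s, v u :=
        intervalIntegral.integral_nonneg hs.1 fun u _ => hv0 u
      calc v s ≤ L * ∫ u in (0 : ℝ)..s, v u := hv s hs
        _ ≤ |L| * ∫ u in (0 : ℝ)..s, v u := mul_le_mul_of_nonneg_right (le_abs_self L) h0
        _ ≤ |L| * (M * (1 / 2) ^ n / κ * Real.exp (κ * s)) :=
          mul_le_mul_of_nonneg_left h1 (abs_nonneg L)
        _ = |L| / κ * (M * (1 / 2) ^ n * Real.exp (κ * s)) := by ring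
        _ ≤ 1 / 2 * (M * (1 / 2) ^ n * Real.exp (κ * s)) := by
          refine mul_le_mul_of_nonneg_right ?_ (by positivity)
          rw [div_le_div_iff₀ hκ two_pos]
          simp only [κ]; linarith
        _ = M * (1 / 2) ^ (n + 1) * Real.exp (κ * s) := by ring
  have hlim : Tendsto (fun n : ℕ => M * (1 / 2 : ℝ) ^ n * Real.exp (κ * t)) atTop (𝓝 0) := by
    have := ((tendsto_pow_atTop_nhds_zero_of_lt_one (r := (1 / 2 : ℝ)) (by norm_num)
      (by norm_num)).const_mul M).mul_const (Real.exp (κ * t))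
    simpa using this
  exact le_antisymm (ge_of_tendsto' hlim fun n => key n t ht) (hv0 t)

/-- By convexity, `exp` at `x * γ` lies below its chord from `0` to `x * θ`; the sign of `x` plays
no role. -/
lemma exp_mul_sub_one_le {γ θ x : ℝ} (hγ : 0 ≤ γ) (hγθ : γ ≤ θ) (hθ : 0 < θ) :
    Real.exp (x * γ) - 1 ≤ γ / θ * (Real.exp (x * θ) - 1) := by
  have h := convexOn_exp.2 (mem_univ (0 : ℝ)) (mem_univ (x * θ))
    (show 0 ≤ 1 - γ / θ by rw [sub_nonneg, div_le_one hθ]; exact hγθ) (show 0 ≤ γ / θ by positivity) (by ring)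
  simp only [smul_eq_mul, mul_zero, zero_add, Real.exp_zero, mul_one] at h
  rw [show γ / θ * (x * θ) = x * γ by field_simp] at h
  linarith

/-- Joint measurability of an integral over an interval with a moving left end. -/
lemma measurable_intervalIntegral_left {α : Type*} [MeasurableSpace α] {f : α → ℝ → ℂ}
    {g h : α → ℝ} (hf : Measurable (Function.uncurry f)) (hg : Measurable g) (hh : Measurable h) :
    Measurable fun x => ∫ u in g x..h x, f x u := by
  have key : ∀ {g h : α → ℝ}, Measurable g → Measurable h →
      Measurable fun x => ∫ u in Ioc (g x) (h x), f x u := by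
    intro g h hg hh
    have : (fun x => ∫ u in Ioc (g x) (h x), f x u)
        = fun x => ∫ u, (if g x < u ∧ u ≤ h x then f x u else 0) := by
      ext x
      rw [← integral_indicator measurableSet_Ioc]
      simp only [indicator_apply, mem_Ioc]
    rw [this]
    refine (StronglyMeasurable.integral_prod_right (ν := volume)
      (f := fun x u => if g x < u ∧ u ≤ h x then f x u else 0) ?_).measurable
    refine (Measurable.ite ?_ hf measurable_const).stronglyMeasurable
    exact (measurableSet_lt (hg.comp measurable_fst) measurable_snd).inter
      (measurableSet_le measurable_snd (hh.comp measurable_fst))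
  exact (key hg hh).sub (key hh hg)

/-! ### The fixed-point equation -/

/-- The `l`-th component of `∫_0^t φ(s)ᵀ (C(t-s) - 1) ds`. -/
noncomputable def kernelConv (φ : ℝ → Matrix (Fin 2) (Fin 2) ℝ) (C : ℝ → Fin 2 → ℂ)
    (l : Fin 2) (t : ℝ) : ℂ :=
  ∫ s in (0 : ℝ)..t, ∑ m, (φ s m l : ℂ) * (C (t - s) m - 1)

lemma markFactor_eq (φ : ℝ → Matrix (Fin 2) (Fin 2) ℝ) (a : Fin 2 → ℝ) (C : ℝ → Fin 2 → ℂ)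
    (l : Fin 2) (t x : ℝ) :
    markFactor φ a C l t x = Complex.exp (Complex.I * x * a l + x * kernelConv φ C l t) := rfl

lemma norm_markFactor (φ : ℝ → Matrix (Fin 2) (Fin 2) ℝ) (a : Fin 2 → ℝ) (C : ℝ → Fin 2 → ℂ)
    (l : Fin 2) (t x : ℝ) :
    ‖markFactor φ a C l t x‖ = Real.exp (x * (kernelConv φ C l t).re) := by
  rw [markFactor_eq, Complex.norm_exp]
  simp

/-! ### A priori bound for solutions -/

section Kernel

variable {T B : ℝ} {φ : ℝ → Matrix (Fin 2) (Fin 2) ℝ}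
  (hφ_meas : ∀ i j, Measurable fun u => φ u i j)
  (hφ_nonneg : ∀ u, 0 ≤ u → ∀ i j, 0 ≤ φ u i j)
  (hφB : ∀ u ∈ Icc 0 T, ∀ i j, φ u i j ≤ B)

include hφ_meas in
lemma measurable_kernelConv_integrand {C : ℝ → Fin 2 → ℂ} (hC : Measurable C) (l : Fin 2) :
    Measurable fun p : ℝ × ℝ => ∑ m, (φ p.2 m l : ℂ) * (C (p.1 - p.2) m - 1) := by
  refine Finset.measurable_sum _ fun m _ => Measurable.mul ?_ ?_
  · exact Complex.measurable_ofReal.comp ((hφ_meas m l).comp measurable_snd)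
  · exact ((measurable_pi_iff.1 hC m).comp (measurable_fst.sub measurable_snd)).sub_const 1

include hφ_meas hφ_nonneg hφB in
lemma intervalIntegrable_kernelConv {C : ℝ → Fin 2 → ℂ} (hC : Measurable C) {K : ℝ}
    (hCK : ∀ t ∈ Icc 0 T, ∀ m, ‖C t m‖ ≤ K) {t : ℝ} (ht : t ∈ Icc 0 T) (l : Fin 2) :
    IntervalIntegrable (fun s => ∑ m, (φ s m l : ℂ) * (C (t - s) m - 1)) volume 0 t := by
  refine intervalIntegrable_of_measurable_of_bound (K := ∑ _m : Fin 2, B * (K + 1))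
    ((measurable_kernelConv_integrand hφ_meas hC l).comp
      measurable_prodMk_left).aestronglyMeasurable ht.1 fun s hs => ?_
  refine (norm_sum_le _ _).trans (Finset.sum_le_sum fun m _ => ?_)
  have h1 := hφB s ⟨hs.1, hs.2.trans ht.2⟩ m l
  have h0 := hφ_nonneg s hs.1 m l
  have h2 := hCK (t - s) ⟨by linarith [hs.2], by linarith [hs.1, ht.2]⟩ m
  have h3 : ‖C (t - s) m - 1‖ ≤ K + 1 := (norm_sub_le _ _).trans (by simpa using h2)
  rw [norm_mul, Complex.norm_real, Real.norm_of_nonneg h0]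
  exact mul_le_mul h1 h3 (norm_nonneg _) (h0.trans h1)

include hφ_meas hφ_nonneg hφB in
-- Since `Re (C - 1) ≤ ‖C‖ - 1`, only the excess of `C` over the unit disc can make the real part
-- positive.
lemma kernelConv_re_le {C : ℝ → Fin 2 → ℂ} (hC : Measurable C) {K : ℝ}
    (hCK : ∀ t ∈ Icc 0 T, ∀ m, ‖C t m‖ ≤ K) {t : ℝ} (ht : t ∈ Icc 0 T) (l : Fin 2) :
    (kernelConv φ C l t).re ≤ B * ∫ s in (0 : ℝ)..t, ∑ m, max (‖C s m‖ - 1) 0 := by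
  have hint := intervalIntegrable_kernelConv hφ_meas hφ_nonneg hφB hC hCK ht l
  have hre : (kernelConv φ C l t).re
      = ∫ s in (0 : ℝ)..t, (∑ m, (φ s m l : ℂ) * (C (t - s) m - 1)).re := by
    simpa [kernelConv] using (Complex.reCLM.intervalIntegral_comp_comm hint).symm
  have hsub : ∫ s in (0 : ℝ)..t, ∑ m, max (‖C s m‖ - 1) 0
      = ∫ s in (0 : ℝ)..t, ∑ m, max (‖C (t - s) m‖ - 1) 0 := by
    rw [intervalIntegral.integral_comp_sub_left (fun s => ∑ m, max (‖C s m‖ - 1) 0) t, sub_self,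
      sub_zero]
  have hm : Measurable fun s => ∑ m, max (‖C (t - s) m‖ - 1) 0 :=
    Finset.measurable_sum _ fun m _ => (((measurable_pi_iff.1 hC m).comp
      (measurable_const.sub measurable_id)).norm.sub_const 1).max measurable_const
  rw [hre, hsub, ← intervalIntegral.integral_const_mul]
  refine intervalIntegral.integral_mono_on ht.1 ?_ ?_ fun s hs => ?_
  · exact ⟨hint.1.re, hint.2.re⟩
  · refine (intervalIntegrable_of_measurable_of_bound (K := ∑ _m : Fin 2, (|K| + 1))
      hm.aestronglyMeasurable ht.1 fun s hs => ?_).const_mul B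
    refine (norm_sum_le _ _).trans (Finset.sum_le_sum fun m _ => ?_)
    have h2 := hCK (t - s) ⟨by linarith [hs.2], by linarith [hs.1, ht.2]⟩ m
    rw [Real.norm_of_nonneg (le_max_right _ _)]
    refine max_le ?_ (by positivity)
    linarith [le_abs_self K, norm_nonneg (C (t - s) m)]
  · rw [Complex.re_sum, Finset.mul_sum]
    refine Finset.sum_le_sum fun m _ => ?_
    have h1 := hφB s ⟨hs.1, hs.2.trans ht.2⟩ m l
    have h0 := hφ_nonneg s hs.1 m l
    rw [Complex.re_ofReal_mul]
    have h3 : (C (t - s) m - 1).re ≤ max (‖C (t - s) m‖ - 1) 0 := by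
      refine le_trans ?_ (le_max_left _ _)
      simpa using Complex.re_le_norm (C (t - s) m)
    exact (mul_le_mul_of_nonneg_left h3 h0).trans
      (mul_le_mul_of_nonneg_right h1 (le_max_right _ _))

include hφ_meas hφ_nonneg hφB in
/-- Every bounded solution takes values in the closed unit disc. -/
lemma IsSolution.norm_le_one {ν : Measure ℝ} [IsProbabilityMeasure ν] (hν_pos : ∀ᵐ x ∂ν, 0 < x)
    {a : Fin 2 → ℝ} {C : ℝ → Fin 2 → ℂ} (hC : IsSolution T φ ν a C) :
    ∀ t ∈ Icc 0 T, ∀ m, ‖C t m‖ ≤ 1 := by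
  obtain ⟨K, hK⟩ := hC.bounded
  have hgint : ∀ t ∈ Icc 0 T, ∀ l,
      Integrable (fun x => Real.exp (x * (kernelConv φ C l t).re)) ν := fun t ht l => by
    have := (hC.integrable t ht l).norm
    simpa only [norm_markFactor] using this
  have hnorm : ∀ t ∈ Icc 0 T, ∀ l, ‖C t l‖ ≤ ∫ x, Real.exp (x * (kernelConv φ C l t).re) ∂ν :=
    fun t ht l => by
      rw [hC.eq t ht l]
      simpa only [norm_markFactor] using norm_integral_le_integral_norm (markFactor φ a C l t)
  have hle : ∀ t ∈ Icc 0 T, ∀ l, (kernelConv φ C l t).re ≤ 0 → ‖C t l‖ ≤ 1 := fun t ht l h => by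
    refine (hnorm t ht l).trans ?_
    have : ∫ x, Real.exp (x * (kernelConv φ C l t).re) ∂ν ≤ ∫ _, (1 : ℝ) ∂ν := by
      refine integral_mono_ae (hgint t ht l) (integrable_const _) ?_
      filter_upwards [hν_pos] with x hx
      exact Real.exp_le_one_iff.2 (mul_nonpos_of_nonneg_of_nonpos hx.le h)
    simpa using this
  -- Aim: the excess over the unit disc is at most linear in the positive part of `Re (kernelConv
  -- ..)`, which `kernelConv_re_le` bounds by an integral of the excess. The resulting homogeneous
  -- Volterra inequality forces the excess to vanish.
  obtain ⟨L, hL0, hL⟩ : ∃ L : ℝ, 0 ≤ L ∧ ∀ t ∈ Icc 0 T, ∀ l,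
      max (‖C t l‖ - 1) 0 ≤ L * max (kernelConv φ C l t).re 0 := by
    -- No exponential moment of `ν` is given. If the real part takes a positive value `θ`,
    -- integrability of `markFactor` there supplies the moment of order `θ`, and the chord bound
    -- handles every `γ ≤ θ`. If it takes none, there is no excess.
    by_cases hex : ∃ t ∈ Icc 0 T, ∃ l, 0 < (kernelConv φ C l t).re
    · obtain ⟨t₀, ht₀, l₀, hpos⟩ := hex
      set θ := (kernelConv φ C l₀ t₀).re with hθ
      set L₁ := (∫ x, Real.exp (x * θ) ∂ν - 1) / θ with hL₁
      refine ⟨|L₁| + |K| / θ, by positivity, fun t ht l => ?_⟩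
      set γ := (kernelConv φ C l t).re with hγ
      rcases le_or_gt γ 0 with h0 | h0
      · have := hle t ht l h0
        rw [max_eq_right (by linarith)]
        positivity
      · rw [max_eq_left h0.le]
        refine max_le ?_ (by positivity)
        rcases le_total γ θ with h1 | h1
        · have h2 : ∫ x, (Real.exp (x * γ) - 1) ∂ν ≤ ∫ x, γ / θ * (Real.exp (x * θ) - 1) ∂ν :=
            integral_mono ((hgint t ht l).sub (integrable_const _))
              (((hgint t₀ ht₀ l₀).sub (integrable_const _)).const_mul _)
              fun x => exp_mul_sub_one_le h0.le h1 hpos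
          rw [integral_const_mul, integral_sub (hgint t ht l) (integrable_const _),
            integral_sub (hgint t₀ ht₀ l₀) (integrable_const _)] at h2
          simp only [integral_const, probReal_univ, smul_eq_mul, mul_one] at h2
          have h3 := hnorm t ht l
          have h4 : γ / θ * (∫ x, Real.exp (x * θ) ∂ν - 1) = L₁ * γ := by rw [hL₁]; ring
          have h5 : L₁ * γ ≤ |L₁| * γ := mul_le_mul_of_nonneg_right (le_abs_self _) h0.le
          have h6 : 0 ≤ |K| / θ * γ := by positivity
          linarith
        -- Beyond `θ` the assumed bound on `C` is enough, because `γ / θ ≥ 1`.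
        · have h2 := hK t ht l
          have h3 : |K| ≤ |K| / θ * γ := by
            rw [div_mul_eq_mul_div, le_div_iff₀ hpos]
            exact mul_le_mul_of_nonneg_left h1 (abs_nonneg _)
          have h6 : 0 ≤ |L₁| * γ := by positivity
          linarith [le_abs_self K]
    · push Not at hex
      refine ⟨0, le_rfl, fun t ht l => ?_⟩
      have := hle t ht l (hex t ht l)
      simp [this]
  rcases lt_or_ge T 0 with hT | hT
  · intro t ht; exact absurd (ht.1.trans ht.2) (not_le.2 hT)
  have hB : 0 ≤ B := (hφ_nonneg 0 le_rfl 0 0).trans (hφB 0 ⟨le_rfl, hT⟩ 0 0)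
  set v : ℝ → ℝ := fun s => ∑ m, max (‖C s m‖ - 1) 0 with hv
  have hv0 : ∀ s, 0 ≤ v s := fun s => Finset.sum_nonneg fun m _ => le_max_right _ _
  have hvle : ∀ t ∈ Icc 0 T, v t ≤ (2 * L * B) * ∫ s in (0 : ℝ)..t, v s := fun t ht => by
    have hI : 0 ≤ ∫ s in (0 : ℝ)..t, v s :=
      intervalIntegral.integral_nonneg ht.1 fun u _ => hv0 u
    calc v t ≤ ∑ _m : Fin 2, L * (B * ∫ s in (0 : ℝ)..t, v s) := by
          refine Finset.sum_le_sum fun l _ => (hL t ht l).trans ?_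
          refine mul_le_mul_of_nonneg_left (max_le ?_ (by positivity)) hL0
          exact kernelConv_re_le hφ_meas hφ_nonneg hφB hC.measurable hK ht l
      _ = _ := by rw [Fin.sum_univ_two]; ring
  have hvM : ∀ s ∈ Icc 0 T, v s ≤ ∑ _m : Fin 2, |K| := fun s hs => by
    refine Finset.sum_le_sum fun m _ => max_le ?_ (abs_nonneg _)
    linarith [hK s hs m, le_abs_self K]
  intro t ht m
  have h0 := eq_zero_of_le_integral hv0 hvM hvle t ht
  have h1 := (Finset.sum_eq_zero_iff_of_nonneg fun m _ => le_max_right (‖C t m‖ - 1) 0).1 h0 m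
    (Finset.mem_univ m)
  linarith [le_max_left (‖C t m‖ - 1) 0]

include hφ_meas hφ_nonneg hφB in
lemma kernelConv_re_nonpos {C : ℝ → Fin 2 → ℂ} (hC : Measurable C)
    (hC1 : ∀ t ∈ Icc 0 T, ∀ m, ‖C t m‖ ≤ 1) {t : ℝ} (ht : t ∈ Icc 0 T) (l : Fin 2) :
    (kernelConv φ C l t).re ≤ 0 := by
  refine (kernelConv_re_le hφ_meas hφ_nonneg hφB hC hC1 ht l).trans_eq ?_
  rw [intervalIntegral.integral_congr (g := fun _ => (0 : ℝ))]
  · simp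
  · intro s hs
    rw [uIcc_of_le ht.1] at hs
    refine Finset.sum_eq_zero fun m _ => max_eq_right ?_
    linarith [hC1 s ⟨hs.1, hs.2.trans ht.2⟩ m]

include hφ_meas hφ_nonneg hφB in
lemma norm_kernelConv_sub_le {C D : ℝ → Fin 2 → ℂ} (hC : Measurable C) (hD : Measurable D)
    (hC1 : ∀ t ∈ Icc 0 T, ∀ m, ‖C t m‖ ≤ 1) (hD1 : ∀ t ∈ Icc 0 T, ∀ m, ‖D t m‖ ≤ 1)
    {A κ : ℝ} (hκ : 0 < κ) (hA : 0 ≤ A)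
    (hCD : ∀ t ∈ Icc 0 T, ∀ m, ‖C t m - D t m‖ ≤ A * Real.exp (κ * t))
    {t : ℝ} (ht : t ∈ Icc 0 T) (l : Fin 2) :
    ‖kernelConv φ C l t - kernelConv φ D l t‖ ≤ 2 * B * (A / κ * Real.exp (κ * t)) := by
  have hC' := intervalIntegrable_kernelConv hφ_meas hφ_nonneg hφB hC hC1 ht l
  have hD' := intervalIntegrable_kernelConv hφ_meas hφ_nonneg hφB hD hD1 ht l
  have hB : 0 ≤ B := (hφ_nonneg 0 le_rfl 0 0).trans (hφB 0 ⟨le_rfl, ht.1.trans ht.2⟩ 0 0)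
  rw [kernelConv, kernelConv, ← intervalIntegral.integral_sub hC' hD']
  have h1 : ‖∫ s in (0 : ℝ)..t, ((∑ m, (φ s m l : ℂ) * (C (t - s) m - 1))
      - ∑ m, (φ s m l : ℂ) * (D (t - s) m - 1))‖
      ≤ ∫ s in (0 : ℝ)..t, 2 * B * (A * Real.exp (κ * (t - s))) := by
    refine intervalIntegral.norm_integral_le_of_norm_le ht.1 (ae_of_all _ fun s hs => ?_)
      (Continuous.intervalIntegrable (by fun_prop) _ _)
    rw [← Finset.sum_sub_distrib]
    refine (norm_sum_le _ _).trans ?_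
    have : ∀ m : Fin 2, ‖(φ s m l : ℂ) * (C (t - s) m - 1) - (φ s m l : ℂ) * (D (t - s) m - 1)‖
        ≤ B * (A * Real.exp (κ * (t - s))) := fun m => by
      rw [← mul_sub, norm_mul, Complex.norm_real, Real.norm_of_nonneg (hφ_nonneg s hs.1.le m l),
        sub_sub_sub_cancel_right]
      exact mul_le_mul (hφB s ⟨hs.1.le, hs.2.trans ht.2⟩ m l)
        (hCD (t - s) ⟨by linarith [hs.2], by linarith [hs.1, ht.2]⟩ m) (norm_nonneg _) hB
    rw [Fin.sum_univ_two]
    linarith [this 0, this 1]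
  refine h1.trans ?_
  rw [intervalIntegral.integral_const_mul,
    intervalIntegral.integral_comp_sub_left (fun s => A * Real.exp (κ * s)) t, sub_self, sub_zero]
  refine mul_le_mul_of_nonneg_left ?_ (by positivity)
  exact integral_le_of_le_exp hκ ht.1 hA (fun s _ => by positivity) fun s _ => le_rfl

include hφ_meas in
lemma measurable_markFactor {C : ℝ → Fin 2 → ℂ} (hC : Measurable C) (a : Fin 2 → ℝ) (l : Fin 2) :
    Measurable fun p : ℝ × ℝ => markFactor φ a C l p.1 p.2 := by
  have h : Measurable fun t => kernelConv φ C l t :=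
    measurable_intervalIntegral_left (measurable_kernelConv_integrand hφ_meas hC l)
      measurable_const measurable_id
  simp only [markFactor_eq]
  have h2 : Measurable fun p : ℝ × ℝ => (p.2 : ℂ) := Complex.measurable_ofReal.comp measurable_snd
  exact (((measurable_const.mul h2).mul_const _).add
    (h2.mul (h.comp measurable_fst))).cexp

include hφ_meas hφ_nonneg hφB in
lemma integrable_markFactor {ν : Measure ℝ} [IsProbabilityMeasure ν] (hν_pos : ∀ᵐ x ∂ν, 0 < x)
    {C : ℝ → Fin 2 → ℂ} (hC : Measurable C) (hC1 : ∀ t ∈ Icc 0 T, ∀ m, ‖C t m‖ ≤ 1)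
    (a : Fin 2 → ℝ) {t : ℝ} (ht : t ∈ Icc 0 T) (l : Fin 2) :
    Integrable (markFactor φ a C l t) ν := by
  refine Integrable.of_bound (C := 1)
    ((measurable_markFactor hφ_meas hC a l).comp measurable_prodMk_left).aestronglyMeasurable ?_
  filter_upwards [hν_pos] with x hx
  rw [norm_markFactor]
  exact Real.exp_le_one_iff.2 (mul_nonpos_of_nonneg_of_nonpos hx.le
    (kernelConv_re_nonpos hφ_meas hφ_nonneg hφB hC hC1 ht l))

/-! ### Existence by Picard iteration -/

open Classical in
/-- The map whose fixed points are the solutions. -/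
noncomputable def picardMap (T : ℝ) (φ : ℝ → Matrix (Fin 2) (Fin 2) ℝ) (ν : Measure ℝ)
    (a : Fin 2 → ℝ) (C : ℝ → Fin 2 → ℂ) : ℝ → Fin 2 → ℂ :=
  fun t l => if t ∈ Icc 0 T then ∫ x, markFactor φ a C l t x ∂ν else 1

include hφ_meas in
lemma measurable_picardMap {ν : Measure ℝ} [IsProbabilityMeasure ν] {C : ℝ → Fin 2 → ℂ}
    (hC : Measurable C) (a : Fin 2 → ℝ) : Measurable (picardMap T φ ν a C) := by
  refine measurable_pi_iff.2 fun l => Measurable.ite measurableSet_Icc ?_ measurable_const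
  exact (StronglyMeasurable.integral_prod_right
    (measurable_markFactor hφ_meas hC a l).stronglyMeasurable).measurable

include hφ_meas hφ_nonneg hφB in
lemma norm_picardMap_le {ν : Measure ℝ} [IsProbabilityMeasure ν] (hν_pos : ∀ᵐ x ∂ν, 0 < x)
    {C : ℝ → Fin 2 → ℂ} (hC : Measurable C) (hC1 : ∀ t ∈ Icc 0 T, ∀ m, ‖C t m‖ ≤ 1)
    (a : Fin 2 → ℝ) (t : ℝ) (l : Fin 2) : ‖picardMap T φ ν a C t l‖ ≤ 1 := by
  unfold picardMap
  split_ifs with ht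
  · refine (norm_integral_le_of_norm_le_const (C := 1) ?_).trans (by simp)
    filter_upwards [hν_pos] with x hx
    rw [norm_markFactor]
    exact Real.exp_le_one_iff.2 (mul_nonpos_of_nonneg_of_nonpos hx.le
      (kernelConv_re_nonpos hφ_meas hφ_nonneg hφB hC hC1 ht l))
  · simp

include hφ_meas hφ_nonneg hφB in
-- The two types give `2 * B * A / κ` for the convolutions, and the Lipschitz bound on `exp` adds a
-- factor `E(J)`. The choice of `κ` makes the product at most `A / 2`.
lemma norm_picardMap_sub_le {ν : Measure ℝ} [IsProbabilityMeasure ν] (hν_pos : ∀ᵐ x ∂ν, 0 < x)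
    (hν : Integrable (fun x => x) ν) {C D : ℝ → Fin 2 → ℂ} (hC : Measurable C) (hD : Measurable D)
    (hC1 : ∀ t ∈ Icc 0 T, ∀ m, ‖C t m‖ ≤ 1) (hD1 : ∀ t ∈ Icc 0 T, ∀ m, ‖D t m‖ ≤ 1)
    {A κ : ℝ} (hκ : 0 < κ) (hκB : 4 * B * ∫ x, x ∂ν ≤ κ) (hA : 0 ≤ A)
    (hCD : ∀ t ∈ Icc 0 T, ∀ m, ‖C t m - D t m‖ ≤ A * Real.exp (κ * t))
    (a : Fin 2 → ℝ) {t : ℝ} (ht : t ∈ Icc 0 T) (l : Fin 2) :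
    ‖picardMap T φ ν a C t l - picardMap T φ ν a D t l‖ ≤ A / 2 * Real.exp (κ * t) := by
  simp only [picardMap, if_pos ht]
  rw [← integral_sub (integrable_markFactor hφ_meas hφ_nonneg hφB hν_pos hC hC1 a ht l)
    (integrable_markFactor hφ_meas hφ_nonneg hφB hν_pos hD hD1 a ht l)]
  have hcd := norm_kernelConv_sub_le hφ_meas hφ_nonneg hφB hC hD hC1 hD1 hκ hA hCD ht l
  have hCre := kernelConv_re_nonpos hφ_meas hφ_nonneg hφB hC hC1 ht l
  have hDre := kernelConv_re_nonpos hφ_meas hφ_nonneg hφB hD hD1 ht l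
  set δ := 2 * B * (A / κ * Real.exp (κ * t)) with hδ
  have h1 : ‖∫ x, (markFactor φ a C l t x - markFactor φ a D l t x) ∂ν‖ ≤ ∫ x, x * δ ∂ν := by
    refine norm_integral_le_of_norm_le (hν.mul_const δ) ?_
    filter_upwards [hν_pos] with x hx
    rw [markFactor_eq, markFactor_eq]
    refine (norm_exp_sub_exp_le ?_ ?_).trans ?_
    · simpa using mul_nonpos_of_nonneg_of_nonpos hx.le hCre
    · simpa using mul_nonpos_of_nonneg_of_nonpos hx.le hDre
    · rw [add_sub_add_left_eq_sub, ← mul_sub, norm_mul, Complex.norm_real,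
        Real.norm_of_nonneg hx.le]
      exact mul_le_mul_of_nonneg_left hcd hx.le
  refine h1.trans ?_
  rw [integral_mul_const]
  have h2 : (∫ x, x ∂ν) * δ = (4 * B * ∫ x, x ∂ν) / κ * (A / 2 * Real.exp (κ * t)) := by
    rw [hδ]; ring
  rw [h2]
  refine mul_le_of_le_one_left (by positivity) ?_
  exact (div_le_one hκ).2 hκB

include hφ_meas hφ_nonneg hφB in
theorem exists_isSolution {ν : Measure ℝ} [IsProbabilityMeasure ν] (hν_pos : ∀ᵐ x ∂ν, 0 < x)
    (hν : Integrable (fun x => x) ν) (a : Fin 2 → ℝ) : ∃ C, IsSolution T φ ν a C := by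
  set S : ℕ → ℝ → Fin 2 → ℂ := fun n => (picardMap T φ ν a)^[n] (fun _ _ => 1) with hS
  have hSsucc : ∀ n, S (n + 1) = picardMap T φ ν a (S n) := fun n =>
    Function.iterate_succ_apply' _ _ _
  have hSm : ∀ n, Measurable (S n) := by
    intro n
    induction n with
    | zero => exact measurable_const
    | succ n ih => rw [hSsucc]; exact measurable_picardMap hφ_meas ih a
  have hS1 : ∀ n t m, ‖S n t m‖ ≤ 1 := by
    intro n
    induction n with
    | zero => intro t m; simp [hS]
    | succ n ih =>
      rw [hSsucc]
      exact norm_picardMap_le hφ_meas hφ_nonneg hφB hν_pos (hSm n) (fun t _ => ih t) a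
  set κ : ℝ := |4 * B * ∫ x, x ∂ν| + 1 with hκdef
  have hκ : 0 < κ := by positivity
  have hκB : 4 * B * ∫ x, x ∂ν ≤ κ := (le_abs_self _).trans (by linarith)
  -- All iterates equal 1 off the horizon, so they converge at every real time and the limit is
  -- measurable on the whole line.
  have hout : ∀ n t, t ∉ Icc 0 T → ∀ m, S n t m = 1 := by
    intro n t ht m
    cases n with
    | zero => rfl
    | succ n => rw [hSsucc]; simp only [picardMap, if_neg ht]
  have hstep : ∀ n, ∀ t ∈ Icc 0 T, ∀ m,
      ‖S n t m - S (n + 1) t m‖ ≤ 2 * (1 / 2) ^ n * Real.exp (κ * t) := by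
    intro n
    induction n with
    | zero =>
      intro t ht m
      have h1 : 1 ≤ Real.exp (κ * t) := Real.one_le_exp (mul_nonneg hκ.le ht.1)
      have h2 := (norm_sub_le (S 0 t m) (S (0 + 1) t m)).trans (add_le_add (hS1 _ _ _) (hS1 _ _ _))
      simp only [pow_zero, mul_one]
      linarith
    | succ n ih =>
      intro t ht m
      rw [hSsucc, hSsucc (n + 1)]
      refine (norm_picardMap_sub_le hφ_meas hφ_nonneg hφB hν_pos hν (hSm n) (hSm (n + 1))
        (fun t _ => hS1 n t) (fun t _ => hS1 (n + 1) t) hκ hκB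
        (by positivity) ih a ht m).trans_eq ?_
      ring
  have hstep' : ∀ t m n, dist (S n t m) (S (n + 1) t m) ≤ 2 * Real.exp (κ * t) * (1 / 2) ^ n := by
    intro t m n
    rw [dist_eq_norm]
    by_cases ht : t ∈ Icc 0 T
    · refine (hstep n t ht m).trans_eq (by ring)
    · rw [hout n t ht, hout (n + 1) t ht, sub_self, norm_zero]
      positivity
  have hlim : ∀ t m, ∃ z, Tendsto (fun n => S n t m) atTop (𝓝 z) := fun t m =>
    cauchySeq_tendsto_of_complete
      (cauchySeq_of_le_geometric (1 / 2) _ (by norm_num) (hstep' t m))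
  choose C hClim using hlim
  have hCm : Measurable C := measurable_of_tendsto_metrizable hSm
    (tendsto_pi_nhds.2 fun t => tendsto_pi_nhds.2 fun m => hClim t m)
  have hC1 : ∀ t m, ‖C t m‖ ≤ 1 := fun t m =>
    le_of_tendsto' (hClim t m).norm fun n => hS1 n t m
  -- The geometric tail `2 * ∑ (1/2)^k` over `k ≥ n` gives the constant 4.
  have hdist : ∀ n t m, ‖S n t m - C t m‖ ≤ 4 * (1 / 2) ^ n * Real.exp (κ * t) := fun n t m => by
    have := dist_le_of_le_geometric_of_tendsto (1 / 2) _ (by norm_num) (hstep' t m) (hClim t m) n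
    rw [dist_eq_norm] at this
    refine this.trans_eq ?_
    ring
  refine ⟨C, hCm, ⟨1, fun t _ => hC1 t⟩, fun t ht l =>
    integrable_markFactor hφ_meas hφ_nonneg hφB hν_pos hCm (fun t _ => hC1 t) a ht l,
    fun t ht l => ?_⟩
  have h1 : ∀ n : ℕ, ‖S (n + 1) t l - picardMap T φ ν a C t l‖
      ≤ 2 * Real.exp (κ * t) * (1 / 2) ^ n := fun n => by
    rw [hSsucc]
    refine (norm_picardMap_sub_le hφ_meas hφ_nonneg hφB hν_pos hν (hSm n) hCm
      (fun t _ => hS1 n t) (fun t _ => hC1 t) hκ hκB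
      (by positivity) (fun t _ m => hdist n t m) a ht l).trans_eq ?_
    ring
  have h2 : Tendsto (fun n => S (n + 1) t l) atTop (𝓝 (picardMap T φ ν a C t l)) := by
    refine tendsto_iff_norm_sub_tendsto_zero.2 (squeeze_zero (fun _ => norm_nonneg _) h1 ?_)
    simpa using (tendsto_pow_atTop_nhds_zero_of_lt_one (r := (1 / 2 : ℝ)) (by norm_num)
      (by norm_num)).const_mul (2 * Real.exp (κ * t))
  have h3 := tendsto_nhds_unique ((tendsto_add_atTop_iff_nat 1).2 (hClim t l)) h2
  rw [h3]
  simp only [picardMap, if_pos ht]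

end Kernel

/-! ### Predictable processes -/

section Predictable

variable {Ω : Type*} {mΩ : MeasurableSpace Ω} {𝓕 : Filtration ℝ≥0 mΩ}

lemma measurable_predictable_fst : Measurable[𝓕.predictable] (Prod.fst : ℝ≥0 × Ω → ℝ≥0) := by
  refine @measurable_of_Ioi _ _ _ _ _ 𝓕.predictable _ _ _ _ fun i => ?_
  have : (Prod.fst ⁻¹' Ioi i : Set (ℝ≥0 × Ω)) = Ioi i ×ˢ univ := by ext; simp
  rw [this]
  exact measurableSet_predictable_Ioi_prod MeasurableSet.univ

/-- A point of a countable dense set can be put strictly between `τ` and the current time. The set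
is thus a countable union of rectangles `Ioi q ×ˢ (A ∩ {τ ≤ q})`, whose bases belong to the past at
`q`. -/
lemma measurableSet_predictable_lt_inter {τ : Ω → ℝ≥0}
    (hτ : IsStoppingTime 𝓕 fun ω => (τ ω : WithTop ℝ≥0)) {A : Set Ω}
    (hA : MeasurableSet[hτ.measurableSpace] A) :
    MeasurableSet[𝓕.predictable] {p : ℝ≥0 × Ω | τ p.2 < p.1 ∧ p.2 ∈ A} := by
  obtain ⟨D, hDc, hDd⟩ := TopologicalSpace.exists_countable_dense ℝ≥0
  have : {p : ℝ≥0 × Ω | τ p.2 < p.1 ∧ p.2 ∈ A}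
      = ⋃ q ∈ D, Ioi q ×ˢ (A ∩ {ω | (τ ω : WithTop ℝ≥0) ≤ q}) := by
    ext ⟨s, ω⟩
    simp only [mem_ofPred_eq, mem_iUnion, mem_prod, mem_Ioi, mem_inter_iff, WithTop.coe_le_coe,
      exists_prop]
    constructor
    · rintro ⟨h1, h2⟩
      obtain ⟨q, hq, h3, h4⟩ := hDd.exists_between h1
      exact ⟨q, hq, h4, h2, h3.le⟩
    · rintro ⟨q, hq, h4, h2, h3⟩
      exact ⟨h3.trans_lt h4, h2⟩
  rw [this]
  refine MeasurableSet.biUnion hDc fun q _ => ?_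
  exact measurableSet_predictable_Ioi_prod (((hτ.measurableSet A).1 hA).2 q)

lemma measurableSet_predictable_lt {τ : Ω → ℝ≥0}
    (hτ : IsStoppingTime 𝓕 fun ω => (τ ω : WithTop ℝ≥0)) :
    MeasurableSet[𝓕.predictable] {p : ℝ≥0 × Ω | τ p.2 < p.1} := by
  simpa using measurableSet_predictable_lt_inter hτ (A := univ) MeasurableSet.univ

open Classical in
lemma measurable_predictable_ite {τ : Ω → ℝ≥0} {β : Type*} [MeasurableSpace β]
    (hτ : IsStoppingTime 𝓕 fun ω => (τ ω : WithTop ℝ≥0)) {f : Ω → β}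
    (hf : Measurable[hτ.measurableSpace] f) (c : β) :
    Measurable[𝓕.predictable] fun p : ℝ≥0 × Ω => if τ p.2 < p.1 then f p.2 else c := by
  intro S hS
  have : (fun p : ℝ≥0 × Ω => if τ p.2 < p.1 then f p.2 else c) ⁻¹' S
      = {p | τ p.2 < p.1 ∧ p.2 ∈ f ⁻¹' S} ∪ ({p | τ p.2 < p.1}ᶜ ∩ {_p | c ∈ S}) := by
    ext p
    by_cases h : τ p.2 < p.1 <;> simp [h]
  rw [this]
  exact (measurableSet_predictable_lt_inter hτ (hf hS)).union
    ((measurableSet_predictable_lt hτ).compl.inter (MeasurableSet.const _))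

lemma measurable_of_isStoppingTime {τ : Ω → ℝ≥0}
    (hτ : IsStoppingTime 𝓕 fun ω => (τ ω : WithTop ℝ≥0)) :
    Measurable[hτ.measurableSpace] τ := by
  refine @measurable_of_Iic _ _ _ _ _ hτ.measurableSpace _ _ _ _ fun i => ?_
  rw [hτ.measurableSet]
  have h : ∀ j : ℝ≥0, τ ⁻¹' Iic j = {ω | (τ ω : WithTop ℝ≥0) ≤ j} := fun j => by
    ext ω
    change τ ω ≤ j ↔ (τ ω : WithTop ℝ≥0) ≤ j
    exact WithTop.coe_le_coe.symm
  refine ⟨?_, fun j => ?_⟩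
  · rw [h]
    exact (le_iSup (fun i => 𝓕 i) i) _ (hτ i)
  · have : τ ⁻¹' Iic i ∩ {ω | (τ ω : WithTop ℝ≥0) ≤ j}
        = {ω | (τ ω : WithTop ℝ≥0) ≤ (min i j : ℝ≥0)} := by
      ext ω
      change τ ω ≤ i ∧ (τ ω : WithTop ℝ≥0) ≤ j ↔ (τ ω : WithTop ℝ≥0) ≤ (min i j : ℝ≥0)
      rw [WithTop.coe_le_coe, WithTop.coe_le_coe, le_min_iff]
    rw [this]
    exact 𝓕.mono (min_le_right i j) _ (hτ _)

end Predictable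

/-! ### The history of the process before an arrival -/

/-- An arrival: its time, its type and its mark. -/
abbrev Point := ℝ × Fin 2 × ℝ

section Arrivals

variable {Ω : Type*}

/-- The `n`-th arrival. -/
def MarkedPoints.point (X : MarkedPoints Ω) (n : ℕ) (ω : Ω) : Point :=
  (X.time n ω, X.sign n ω, X.mark n ω)

lemma MarkedPoints.measurable_point_of {X : MarkedPoints Ω} [MeasurableSpace Ω] {n : ℕ}
    (ht : Measurable (X.time n)) (hs : Measurable (X.sign n)) (hm : Measurable (X.mark n)) :
    Measurable (X.point n) :=
  (measurable_coe_nnreal_real.comp ht).prodMk (hs.prodMk hm)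

/-- The first `n` arrivals. -/
noncomputable def MarkedPoints.history (X : MarkedPoints Ω) (n : ℕ) (ω : Ω) : ℕ → Point :=
  fun k => if k < n then X.point k ω else 0

/-- The beginning of the time interval which ends with the `n`-th arrival. -/
def MarkedPoints.start (X : MarkedPoints Ω) : ℕ → Ω → ℝ≥0
  | 0, _ => 0
  | n + 1, ω => X.time n ω

/-- The intensity for baseline `b` and kernel `ψ`, given the first `n` arrivals. -/
noncomputable def pointRate (b : ℝ → ℝ) (ψ : ℝ → Matrix (Fin 2) (Fin 2) ℝ) (n : ℕ)
    (z : ℕ → Point) (m : Fin 2) (u : ℝ) : ℝ :=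
  b u + ∑ k ∈ Finset.range n, (z k).2.2 * ψ (u - (z k).1) m (z k).2.1

lemma measurable_pointRate {b : ℝ → ℝ} {ψ : ℝ → Matrix (Fin 2) (Fin 2) ℝ} (hb : Measurable b)
    (hψ : ∀ i j, Measurable fun u => ψ u i j) (n : ℕ) (m : Fin 2) :
    Measurable fun p : (ℕ → Point) × ℝ => pointRate b ψ n p.1 m p.2 := by
  refine (hb.comp measurable_snd).add (Finset.measurable_sum _ fun k _ => ?_)
  have hz : Measurable fun p : (ℕ → Point) × ℝ => p.1 k := (measurable_pi_apply k).comp measurable_fst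
  refine hz.snd.snd.mul ?_
  have h : Measurable fun q : ℝ × Fin 2 => ψ q.1 m q.2 :=
    measurable_from_prod_countable_left fun l => hψ m l
  exact h.comp ((measurable_snd.sub hz.fst).prodMk hz.snd.fst)

lemma MarkedPoints.start_le_time {X : MarkedPoints Ω} {ω : Ω}
    (h : StrictMono fun n => X.time n ω) (n : ℕ) : X.start n ω ≤ X.time n ω := by
  cases n with
  | zero => exact zero_le
  | succ n => exact (h n.lt_succ_self).le

lemma MarkedPoints.time_le_start {X : MarkedPoints Ω} {ω : Ω}
    (h : StrictMono fun n => X.time n ω) {k n : ℕ} (hk : k < n) : X.time k ω ≤ X.start n ω := by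
  cases n with
  | zero => omega
  | succ n => exact h.monotone (Nat.lt_succ_iff.1 hk)

lemma MarkedPoints.time_le_iff {X : MarkedPoints Ω} {ω : Ω}
    (h : StrictMono fun n => X.time n ω) {n : ℕ} {s : ℝ} (h1 : (X.start n ω : ℝ) ≤ s)
    (h2 : s < X.time n ω) (k : ℕ) : (X.time k ω : ℝ) ≤ s ↔ k < n := by
  constructor
  · intro h3
    by_contra hk
    have : (X.time n ω : ℝ) ≤ X.time k ω := NNReal.coe_le_coe.2 (h.monotone (not_lt.1 hk))
    linarith
  · intro hk
    exact (NNReal.coe_le_coe.2 (time_le_start h hk)).trans h1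

/-- Before arrival `n` the infinite sum reduces to the indices below `n`. The bound `s < X.time n ω`
is strict because the intensity already counts an arrival occurring at `s`. -/
lemma MarkedPoints.intensity_eq_pointRate {X : MarkedPoints Ω} {ω : Ω} {T : ℝ} {μ b : ℝ → ℝ}
    {φ ψ : ℝ → Matrix (Fin 2) (Fin 2) ℝ} (hb : ∀ s ∈ Icc 0 T, b s = μ (s / T))
    (hψ : ∀ s ∈ Icc 0 T, ψ s = φ s) (h : StrictMono fun n => X.time n ω) {n : ℕ} {s : ℝ}
    (hs : s ∈ Icc 0 T) (h1 : (X.start n ω : ℝ) ≤ s) (h2 : s < X.time n ω) (m : Fin 2) :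
    X.intensity T μ φ m s ω = pointRate b ψ n (X.history n ω) m s := by
  unfold intensity pointRate integral
  rw [hb s hs]
  congr 1
  have h3 : ∀ l, (∑' k, if (X.time k ω : ℝ) ≤ s ∧ X.sign k ω = l
      then X.mark k ω * φ (s - X.time k ω) m l else 0)
      = ∑ k ∈ Finset.range n, if X.sign k ω = l
      then X.mark k ω * φ (s - X.time k ω) m l else 0 := fun l => by
    rw [tsum_eq_sum (s := Finset.range n)]
    · refine Finset.sum_congr rfl fun k hk => ?_
      simp [(time_le_iff h h1 h2 k).2 (Finset.mem_range.1 hk)]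
    · intro k hk
      rw [if_neg]
      rintro ⟨h4, -⟩
      exact hk (Finset.mem_range.2 ((time_le_iff h h1 h2 k).1 h4))
  simp only [h3]
  rw [Finset.sum_comm]
  refine Finset.sum_congr rfl fun k hk => ?_
  have hk' := Finset.mem_range.1 hk
  have h5 := (time_le_iff h h1 h2 k).2 hk'
  rw [Finset.sum_ite_eq, if_pos (Finset.mem_univ _)]
  simp only [history, point, if_pos hk']
  rw [hψ]
  exact ⟨by linarith, by linarith [hs.2, (X.time k ω).coe_nonneg]⟩

/-! ### The compensation formula between two consecutive arrivals -/

variable {mΩ : MeasurableSpace Ω} {P : Measure Ω} {𝓕 : Filtration ℝ≥0 mΩ} {T : ℝ} {μ b : ℝ → ℝ}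
  {φ ψ : ℝ → Matrix (Fin 2) (Fin 2) ℝ} {ν : Measure ℝ} {X : MarkedPoints Ω}

namespace IsMarkedHawkes

variable (hX : IsMarkedHawkes P 𝓕 T μ φ ν X)
include hX

lemma measurable_point_stopping (n : ℕ) :
    Measurable[(hX.stopping n).measurableSpace] (X.point n) := by
  exact @MarkedPoints.measurable_point_of _ X (hX.stopping n).measurableSpace n
    (measurable_of_isStoppingTime (hX.stopping n)) (hX.sign_measurable n) (hX.mark_measurable n)

lemma measurable_point (n : ℕ) : Measurable (X.point n) :=
  (hX.measurable_point_stopping n).mono (hX.stopping n).measurableSpace_le le_rfl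

lemma measurable_time (n : ℕ) : Measurable (X.time n) :=
  (measurable_of_isStoppingTime (hX.stopping n)).mono (hX.stopping n).measurableSpace_le le_rfl

lemma measurable_sign (n : ℕ) : Measurable (X.sign n) := (hX.measurable_point n).snd.fst

lemma measurable_mark (n : ℕ) : Measurable (X.mark n) := (hX.measurable_point n).snd.snd

lemma measurable_history (n : ℕ) : Measurable (X.history n) := by
  refine measurable_pi_iff.2 fun k => ?_
  unfold MarkedPoints.history
  split_ifs
  · exact hX.measurable_point k
  · exact measurable_const

lemma stopping_start (n : ℕ) : IsStoppingTime 𝓕 fun ω => (X.start n ω : WithTop ℝ≥0) := by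
  cases n with
  | zero => exact isStoppingTime_const 𝓕 0
  | succ n => exact hX.stopping n

lemma measurable_start (n : ℕ) : Measurable (X.start n) :=
  (measurable_of_isStoppingTime (hX.stopping_start n)).mono
    (hX.stopping_start n).measurableSpace_le le_rfl

end IsMarkedHawkes

lemma measurable_ite_comp {α β : Type*} [MeasurableSpace α] [MeasurableSpace β] {c : Set α}
    [DecidablePred (· ∈ c)]
    {f : α → ℝ} {h : α → β} {G : ℝ × β × ℝ → ℝ≥0∞} (hG : Measurable G) (hc : MeasurableSet c)
    (hf : Measurable f) (hh : Measurable h) :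
    Measurable fun q : α × ℝ => if q.1 ∈ c then G (f q.1, h q.1, q.2) else 0 :=
  Measurable.ite (hc.preimage measurable_fst)
    (hG.comp ((hf.comp measurable_fst).prodMk ((hh.comp measurable_fst).prodMk measurable_snd)))
    measurable_const

open Classical in
/-- The density of the compensator on the stochastic interval before the `n`-th arrival. -/
noncomputable def stepDensity (X : MarkedPoints Ω) (b : ℝ → ℝ)
    (ψ : ℝ → Matrix (Fin 2) (Fin 2) ℝ) (n : ℕ) (m : Fin 2) (p : Ω × ℝ) : ℝ≥0∞ :=
  if (X.start n p.1 : ℝ) < p.2 ∧ p.2 ≤ X.time n p.1 then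
    ENNReal.ofReal (pointRate b ψ n (X.history n p.1) m p.2) else 0

namespace IsMarkedHawkes

variable (hX : IsMarkedHawkes P 𝓕 T μ φ ν X)
include hX

lemma measurableSet_step (n : ℕ) :
    MeasurableSet {p : Ω × ℝ | (X.start n p.1 : ℝ) < p.2 ∧ p.2 ≤ X.time n p.1} :=
  (measurableSet_lt (measurable_coe_nnreal_real.comp ((hX.measurable_start n).comp measurable_fst))
    measurable_snd).inter (measurableSet_le measurable_snd
      (measurable_coe_nnreal_real.comp ((hX.measurable_time n).comp measurable_fst)))

lemma measurable_stepDensity (hb : Measurable b) (hψ : ∀ i j, Measurable fun u => ψ u i j) (n : ℕ)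
    (m : Fin 2) : Measurable (stepDensity X b ψ n m) := by
  refine Measurable.ite (hX.measurableSet_step n) ?_ measurable_const
  exact ((measurable_pointRate hb hψ n m).comp
    (((hX.measurable_history n).comp measurable_fst).prodMk measurable_snd)).ennreal_ofReal

open Classical in
-- The compensator formula is applied to an integrand living on the stochastic interval that ends at
-- arrival `n`. There the history of the first `n` arrivals is known, so `G` may depend on it.
lemma lintegral_step (hbμ : ∀ s ∈ Icc 0 T, b s = μ (s / T)) (hψφ : ∀ s ∈ Icc 0 T, ψ s = φ s)
    (n : ℕ) (m : Fin 2) {G : ℝ × (ℕ → Point) × ℝ → ℝ≥0∞} (hG : Measurable G) :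
    ∫⁻ ω, (if (X.time n ω : ℝ) ≤ T ∧ X.sign n ω = m
        then G (X.time n ω, X.history n ω, X.mark n ω) else 0) ∂P
      = ∫⁻ ω, (∫⁻ s in Icc (0 : ℝ) T, stepDensity X b ψ n m (ω, s) *
          ∫⁻ x, G (s, X.history n ω, x) ∂ν) ∂P := by
  -- A predictable version of the history: each arrival is revealed only strictly after it occurs.
  -- It agrees with `X.history n` after `X.start n`.
  set hist : ℝ≥0 × Ω → ℕ → Point := fun p k =>
    if k < n then (if X.time k p.2 < p.1 then X.point k p.2 else 0) else 0 with hhist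
  have hhist_meas : Measurable[𝓕.predictable] hist := by
    refine @measurable_pi_lambda _ _ _ 𝓕.predictable _ _ fun k => ?_
    by_cases hk : k < n
    · simp only [hhist, if_pos hk]
      exact measurable_predictable_ite (hX.stopping k) (hX.measurable_point_stopping k) 0
    · simp only [hhist, if_neg hk]
      exact @measurable_const _ _ _ 𝓕.predictable _
  have hhist_eq : ∀ (s : ℝ≥0) ω, X.start n ω < s → hist (s, ω) = X.history n ω := by
    intro s ω hs
    ext1 k
    simp only [hhist, MarkedPoints.history]
    by_cases hk : k < n
    · rw [if_pos hk, if_pos hk, if_pos]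
      exact (MarkedPoints.time_le_start (hX.time_strictMono ω) hk).trans_lt hs
    · rw [if_neg hk, if_neg hk]
  -- The interval is open on the left and closed on the right, so that arrival `n` is its only atom.
  set c : Set (ℝ≥0 × Ω) := {p | X.start n p.2 < p.1} ∩ {p | X.time n p.2 < p.1}ᶜ with hc
  have hcm : MeasurableSet[𝓕.predictable] c :=
    (measurableSet_predictable_lt (hX.stopping_start n)).inter
      (measurableSet_predictable_lt (hX.stopping n)).compl
  set H : (ℝ≥0 × Ω) × ℝ → ℝ≥0∞ := fun q =>
    if q.1 ∈ c then G ((q.1.1 : ℝ), hist q.1, q.2) else 0 with hH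
  have hHm : Measurable[𝓕.predictable.prod inferInstance] H :=
    @measurable_ite_comp _ _ 𝓕.predictable _ c _ (fun p => (p.1 : ℝ)) hist G hG hcm
      (measurable_coe_nnreal_real.comp measurable_predictable_fst) hhist_meas
  have hcomp := hX.compensator m H hHm
  have hstart : ∀ ω, X.start n ω < X.time n ω := by
    intro ω
    cases n with
    | zero => exact hX.time_pos ω
    | succ n => exact hX.time_strictMono ω n.lt_succ_self
  convert! hcomp using 1
  · refine lintegral_congr fun ω => ?_
    rw [tsum_eq_single n]
    · have hmem : (X.time n ω, ω) ∈ c := ⟨hstart ω, lt_irrefl (X.time n ω)⟩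
      simp only [hH, if_pos hmem, hhist_eq _ ω (hstart ω)]
    · intro k hk
      have hmem : (X.time k ω, ω) ∉ c := by
        rintro ⟨h1, h2⟩
        have h2' : X.time k ω ≤ X.time n ω := not_lt.1 h2
        rcases lt_or_gt_of_ne hk with h | h
        · exact absurd h1 (not_lt.2 (MarkedPoints.time_le_start (hX.time_strictMono ω) h))
        · exact absurd h2' (not_le.2 (hX.time_strictMono ω h))
      simp [hH, hmem]
  · refine lintegral_congr fun ω => ?_
    refine setLIntegral_congr_fun_ae measurableSet_Icc ?_
    -- At the arrival itself the intensity and the frozen rate may differ; one point is negligible.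
    have : ∀ᵐ s : ℝ, s ≠ X.time n ω := by
      simp [ae_iff, measure_singleton]
    filter_upwards [this] with s hne hs
    have hcoe : ((s.toNNReal : ℝ≥0) : ℝ) = s := Real.coe_toNNReal s hs.1
    by_cases hin : (X.start n ω : ℝ) < s ∧ s ≤ X.time n ω
    · have h1 : X.start n ω < s.toNNReal := by
        rw [← NNReal.coe_lt_coe, hcoe]; exact hin.1
      have h2 : s.toNNReal ≤ X.time n ω := by
        rw [← NNReal.coe_le_coe, hcoe]; exact hin.2
      have hmem : (s.toNNReal, ω) ∈ c := ⟨h1, not_lt.2 h2⟩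
      rw [MarkedPoints.intensity_eq_pointRate hbμ hψφ (hX.time_strictMono ω) hs hin.1.le
        (lt_of_le_of_ne hin.2 hne)]
      simp only [hH, if_pos hmem, hhist_eq _ ω h1, stepDensity, if_pos hin, hcoe]
      rw [mul_comm]
    · have hmem : (s.toNNReal, ω) ∉ c := by
        rintro ⟨h1, h2⟩
        refine hin ⟨?_, ?_⟩
        · rw [← hcoe]; exact NNReal.coe_lt_coe.2 h1
        · rw [← hcoe]; exact NNReal.coe_le_coe.2 (not_lt.1 h2)
      simp [hH, hmem, stepDensity, hin]

variable [IsProbabilityMeasure ν]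

/-- The compensation formula, restricted to the `n`-th arrival, as an equality of measures. -/
lemma map_step_eq (hb : Measurable b) (hψ : ∀ i j, Measurable fun u => ψ u i j)
    (hbμ : ∀ s ∈ Icc 0 T, b s = μ (s / T)) (hψφ : ∀ s ∈ Icc 0 T, ψ s = φ s)
    (n : ℕ) (m : Fin 2) :
    (P.restrict {ω | (X.time n ω : ℝ) ≤ T ∧ X.sign n ω = m}).map
        (fun ω => ((X.time n ω : ℝ), X.history n ω, X.mark n ω))
      = (((P.prod (volume.restrict (Icc (0 : ℝ) T))).withDensity (stepDensity X b ψ n m)).prod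
          ν).map (fun q => (q.1.2, X.history n q.1.1, q.2)) := by
  classical
  have hE : MeasurableSet {ω | (X.time n ω : ℝ) ≤ T ∧ X.sign n ω = m} :=
    (measurableSet_le (measurable_coe_nnreal_real.comp (hX.measurable_time n))
      measurable_const).inter (measurableSet_eq_fun (hX.measurable_sign n) measurable_const)
  have hm1 : Measurable fun ω => ((X.time n ω : ℝ), X.history n ω, X.mark n ω) :=
    (measurable_coe_nnreal_real.comp (hX.measurable_time n)).prodMk
      ((hX.measurable_history n).prodMk (hX.measurable_mark n))
  have hm2 : Measurable fun q : (Ω × ℝ) × ℝ => (q.1.2, X.history n q.1.1, q.2) :=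
    measurable_fst.snd.prodMk (((hX.measurable_history n).comp measurable_fst.fst).prodMk
      measurable_snd)
  refine Measure.ext_of_lintegral _ fun G hG => ?_
  have hδ := hX.measurable_stepDensity hb hψ n m
  have hG2 : Measurable fun q : (Ω × ℝ) × ℝ => G (q.1.2, X.history n q.1.1, q.2) := hG.comp hm2
  have hGx : Measurable fun p : Ω × ℝ => ∫⁻ x, G (p.2, X.history n p.1, x) ∂ν :=
    Measurable.lintegral_prod_right hG2
  rw [lintegral_map hG hm1, lintegral_map hG hm2, ← lintegral_indicator hE,
    lintegral_prod _ hG2.aemeasurable, lintegral_withDensity_eq_lintegral_mul _ hδ hGx,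
    lintegral_prod _ (hδ.mul hGx).aemeasurable]
  have := hX.lintegral_step hbμ hψφ n m hG
  simpa only [indicator_apply, mem_ofPred_eq, Pi.mul_apply] using this

/-- The equality of measures carries the identity over to complex integrands. It also carries
integrability: the arrival side is bounded under a probability measure, so no moment of the
intensity has to be estimated. -/
lemma integral_step [IsProbabilityMeasure P] (hb : Measurable b) (hψ : ∀ i j, Measurable fun u => ψ u i j)
    (hbμ : ∀ s ∈ Icc 0 T, b s = μ (s / T)) (hψφ : ∀ s ∈ Icc 0 T, ψ s = φ s)
    (n : ℕ) (m : Fin 2) {G : ℝ × (ℕ → Point) × ℝ → ℂ} (hG : Measurable G) {K : ℝ}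
    (hK : ∀ᵐ ω ∂P, ‖G (X.time n ω, X.history n ω, X.mark n ω)‖ ≤ K) :
    Integrable (fun p : Ω × ℝ => (stepDensity X b ψ n m p).toReal •
        ∫ x, G (p.2, X.history n p.1, x) ∂ν) (P.prod (volume.restrict (Icc (0 : ℝ) T))) ∧
      ∫ ω in {ω | (X.time n ω : ℝ) ≤ T ∧ X.sign n ω = m},
          G (X.time n ω, X.history n ω, X.mark n ω) ∂P
        = ∫ p : Ω × ℝ, (stepDensity X b ψ n m p).toReal •
          (∫ x, G (p.2, X.history n p.1, x) ∂ν) ∂(P.prod (volume.restrict (Icc (0 : ℝ) T))) := by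
  have hm1 : Measurable fun ω => ((X.time n ω : ℝ), X.history n ω, X.mark n ω) :=
    (measurable_coe_nnreal_real.comp (hX.measurable_time n)).prodMk
      ((hX.measurable_history n).prodMk (hX.measurable_mark n))
  have hm2 : Measurable fun q : (Ω × ℝ) × ℝ => (q.1.2, X.history n q.1.1, q.2) :=
    measurable_fst.snd.prodMk (((hX.measurable_history n).comp measurable_fst.fst).prodMk
      measurable_snd)
  have hδ := hX.measurable_stepDensity hb hψ n m
  have hδ_top : ∀ᵐ p ∂(P.prod (volume.restrict (Icc (0 : ℝ) T))), stepDensity X b ψ n m p < ∞ :=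
    ae_of_all _ fun p => by
      unfold stepDensity
      split_ifs
      · exact ENNReal.ofReal_lt_top
      · exact ENNReal.zero_lt_top
  have hmap := hX.map_step_eq hb hψ hbμ hψφ n m
  have hint1 : Integrable G ((P.restrict {ω | (X.time n ω : ℝ) ≤ T ∧ X.sign n ω = m}).map
      (fun ω => ((X.time n ω : ℝ), X.history n ω, X.mark n ω))) := by
    rw [integrable_map_measure hG.aestronglyMeasurable hm1.aemeasurable]
    exact Integrable.of_bound (hG.comp hm1).aestronglyMeasurable K (ae_restrict_of_ae hK)
  have hint2 : Integrable (fun q : (Ω × ℝ) × ℝ => G (q.1.2, X.history n q.1.1, q.2))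
      (((P.prod (volume.restrict (Icc (0 : ℝ) T))).withDensity (stepDensity X b ψ n m)).prod ν) := by
    rw [hmap, integrable_map_measure hG.aestronglyMeasurable hm2.aemeasurable] at hint1
    exact hint1
  refine ⟨(integrable_withDensity_iff_integrable_smul' hδ hδ_top).1 hint2.integral_prod_left, ?_⟩
  rw [← integral_map hm1.aemeasurable (f := G) hG.aestronglyMeasurable, hmap,
    integral_map hm2.aemeasurable hG.aestronglyMeasurable, integral_prod _ hint2,
    integral_withDensity_eq_integral_toReal_smul hδ hδ_top]

end IsMarkedHawkes

end Arrivals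

/-! ### The exponential martingale -/

/-- Baseline `b`, kernel `ψ` and integrand `d` are measurable and bounded, `b` and `ψ` are
nonnegative, and `d` has nonpositive real part. -/
structure IsAdmissible (b : ℝ → ℝ) (ψ : ℝ → Matrix (Fin 2) (Fin 2) ℝ) (d : Fin 2 → ℝ → ℂ)
    (K : ℝ) : Prop where
  measurable_baseline : Measurable b
  measurable_kernel : ∀ i j, Measurable fun u => ψ u i j
  measurable_integrand : ∀ m, Measurable (d m)
  baseline_nonneg : ∀ u, 0 ≤ b u
  baseline_le : ∀ u, b u ≤ K
  kernel_nonneg : ∀ u i j, 0 ≤ ψ u i j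
  kernel_le : ∀ u i j, ψ u i j ≤ K
  integrand_re : ∀ m u, (d m u).re ≤ 0
  integrand_le : ∀ m u, ‖d m u‖ ≤ K

/-- The drift of the exponential martingale, given the first `n` arrivals. -/
noncomputable def pointDrift (b : ℝ → ℝ) (ψ : ℝ → Matrix (Fin 2) (Fin 2) ℝ) (d : Fin 2 → ℝ → ℂ)
    (n : ℕ) (z : ℕ → Point) (u : ℝ) : ℂ :=
  ∑ m, (pointRate b ψ n z m u : ℂ) * d m u

/-- The value of `a₊ f⁺ + a₋ f⁻` at time `t`, counting only the first `n` arrivals. -/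
noncomputable def pointCharge (a : Fin 2 → ℝ) (t : ℝ) (n : ℕ) (z : ℕ → Point) : ℝ :=
  ∑ k ∈ Finset.range n, if (z k).1 ≤ t then (z k).2.2 * a (z k).2.1 else 0

/-- The exponential martingale, given the first `n` arrivals. -/
noncomputable def pointExp (b : ℝ → ℝ) (ψ : ℝ → Matrix (Fin 2) (Fin 2) ℝ) (d : Fin 2 → ℝ → ℂ)
    (a : Fin 2 → ℝ) (t : ℝ) (n : ℕ) (z : ℕ → Point) (s : ℝ) : ℂ :=
  Complex.exp (Complex.I * pointCharge a t n z + ∫ u in s..t, pointDrift b ψ d n z u)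

/-- The factor by which an arrival of type `l` at time `s` with mark `x` multiplies the exponential
martingale. -/
noncomputable def jumpFactor (ψ : ℝ → Matrix (Fin 2) (Fin 2) ℝ) (d : Fin 2 → ℝ → ℂ)
    (a : Fin 2 → ℝ) (t : ℝ) (l : Fin 2) (s x : ℝ) : ℂ :=
  Complex.exp (Complex.I * x * a l + x * ∫ u in s..t, ∑ m, (ψ (u - s) m l : ℂ) * d m u)

/-! ### The exponential for a frozen list of arrivals -/

section Point

variable {b : ℝ → ℝ} {ψ : ℝ → Matrix (Fin 2) (Fin 2) ℝ} {d : Fin 2 → ℝ → ℂ} {K : ℝ}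
  {a : Fin 2 → ℝ} {t : ℝ}

lemma pointRate_congr {n : ℕ} {z w : ℕ → Point} (h : ∀ k < n, z k = w k) (m : Fin 2) (u : ℝ) :
    pointRate b ψ n z m u = pointRate b ψ n w m u := by
  unfold pointRate
  congr 1
  exact Finset.sum_congr rfl fun k hk => by rw [h k (Finset.mem_range.1 hk)]

lemma pointExp_congr {n : ℕ} {z w : ℕ → Point} (h : ∀ k < n, z k = w k) (s : ℝ) :
    pointExp b ψ d a t n z s = pointExp b ψ d a t n w s := by
  have h1 : pointCharge a t n z = pointCharge a t n w :=
    Finset.sum_congr rfl fun k hk => by rw [h k (Finset.mem_range.1 hk)]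
  simp only [pointExp, pointDrift, h1, pointRate_congr h]

namespace IsAdmissible

variable (hA : IsAdmissible b ψ d K)
include hA

lemma bound_nonneg : 0 ≤ K := (hA.baseline_nonneg 0).trans (hA.baseline_le 0)

lemma measurable_pointDrift (n : ℕ) :
    Measurable fun p : (ℕ → Point) × ℝ => pointDrift b ψ d n p.1 p.2 :=
  Finset.measurable_sum _ fun m _ => (Complex.measurable_ofReal.comp
    (measurable_pointRate hA.measurable_baseline hA.measurable_kernel n m)).mul
      ((hA.measurable_integrand m).comp measurable_snd)

lemma measurable_pointExp (n : ℕ) :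
    Measurable fun p : ℝ × (ℕ → Point) => pointExp b ψ d a t n p.2 p.1 := by
  refine Measurable.cexp (Measurable.add (measurable_const.mul (Complex.measurable_ofReal.comp
    (Finset.measurable_sum _ fun k _ => ?_))) ?_)
  · have hz : Measurable fun p : ℝ × (ℕ → Point) => p.2 k :=
      (measurable_pi_apply k).comp measurable_snd
    exact Measurable.ite (measurableSet_le hz.fst measurable_const)
      (hz.snd.snd.mul ((measurable_of_countable a).comp hz.snd.fst)) measurable_const
  · refine measurable_intervalIntegral_left
      (f := fun (p : ℝ × (ℕ → Point)) u => pointDrift b ψ d n p.2 u) ?_ measurable_fst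
      measurable_const
    exact (hA.measurable_pointDrift n).comp (measurable_fst.snd.prodMk measurable_snd)

lemma measurable_pointExp_comp {α : Type*} [MeasurableSpace α] {f : α → ℝ} {h : α → ℕ → Point}
    (hf : Measurable f) (hh : Measurable h) (n : ℕ) :
    Measurable fun x => pointExp b ψ d a t n (h x) (f x) := by
  have h1 := (hA.measurable_pointExp (a := a) (t := t) n).comp (hf.prodMk hh)
  exact h1

lemma measurable_jumpFactor (l : Fin 2) :
    Measurable fun p : ℝ × ℝ => jumpFactor ψ d a t l p.1 p.2 := by
  have h2 : Measurable fun p : ℝ × ℝ => (p.2 : ℂ) := Complex.measurable_ofReal.comp measurable_snd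
  refine (((measurable_const.mul h2).mul_const _).add (h2.mul ?_)).cexp
  have : Measurable fun s => ∫ u in s..t, ∑ m, (ψ (u - s) m l : ℂ) * d m u := by
    refine measurable_intervalIntegral_left
      (f := fun s u => ∑ m, (ψ (u - s) m l : ℂ) * d m u) ?_ measurable_id measurable_const
    refine Finset.measurable_sum _ fun m _ => Measurable.mul ?_ ?_
    · exact Complex.measurable_ofReal.comp ((hA.measurable_kernel m l).comp
        (measurable_snd.sub measurable_fst))
    · exact (hA.measurable_integrand m).comp measurable_snd
  exact this.comp measurable_fst

lemma measurable_jumpFactor_comp {α : Type*} [MeasurableSpace α] {f g : α → ℝ}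
    (hf : Measurable f) (hg : Measurable g) (l : Fin 2) :
    Measurable fun x => jumpFactor ψ d a t l (f x) (g x) := by
  have h1 := (hA.measurable_jumpFactor (a := a) (t := t) l).comp (hf.prodMk hg)
  exact h1

lemma norm_pointRate_le (n : ℕ) (z : ℕ → Point) (m : Fin 2) (u : ℝ) :
    |pointRate b ψ n z m u| ≤ K + ∑ k ∈ Finset.range n, |(z k).2.2| * K := by
  unfold pointRate
  refine (abs_add_le _ _).trans (add_le_add ?_ ((Finset.abs_sum_le_sum_abs _ _).trans
    (Finset.sum_le_sum fun k _ => ?_)))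
  · rw [abs_of_nonneg (hA.baseline_nonneg u)]; exact hA.baseline_le u
  · rw [abs_mul, abs_of_nonneg (hA.kernel_nonneg _ _ _)]
    exact mul_le_mul_of_nonneg_left (hA.kernel_le _ _ _) (abs_nonneg _)

lemma exists_norm_pointDrift_le (n : ℕ) (z : ℕ → Point) :
    ∃ M, ∀ u, ‖pointDrift b ψ d n z u‖ ≤ M := by
  refine ⟨∑ _m : Fin 2, (K + ∑ k ∈ Finset.range n, |(z k).2.2| * K) * K, fun u =>
    (norm_sum_le _ _).trans (Finset.sum_le_sum fun m _ => ?_)⟩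
  rw [norm_mul, Complex.norm_real]
  have hK := hA.bound_nonneg
  exact mul_le_mul (hA.norm_pointRate_le n z m u) (hA.integrand_le m u) (norm_nonneg _)
    (by positivity)

lemma intervalIntegrable_pointDrift (n : ℕ) (z : ℕ → Point) {r s : ℝ} (hrs : r ≤ s) :
    IntervalIntegrable (pointDrift b ψ d n z) volume r s := by
  obtain ⟨M, hM⟩ := hA.exists_norm_pointDrift_le n z
  exact intervalIntegrable_of_measurable_of_bound
    ((hA.measurable_pointDrift n).comp measurable_prodMk_left).aestronglyMeasurable hrs
    fun u _ => hM u

lemma intervalIntegrable_jump (l : Fin 2) {s : ℝ} (hst : s ≤ t) :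
    IntervalIntegrable (fun u => ∑ m, (ψ (u - s) m l : ℂ) * d m u) volume s t := by
  refine intervalIntegrable_of_measurable_of_bound (K := ∑ _m : Fin 2, K * K)
    (Measurable.aestronglyMeasurable ?_) hst fun u _ =>
      (norm_sum_le _ _).trans (Finset.sum_le_sum fun m _ => ?_)
  · exact Finset.measurable_sum _ fun m _ => Measurable.mul (Complex.measurable_ofReal.comp
      ((hA.measurable_kernel m l).comp (measurable_id.sub_const s))) (hA.measurable_integrand m)
  · rw [norm_mul, Complex.norm_real, Real.norm_of_nonneg (hA.kernel_nonneg _ _ _)]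
    exact mul_le_mul (hA.kernel_le _ _ _) (hA.integrand_le m u) (norm_nonneg _) hA.bound_nonneg

/-- The exponent is additive over arrivals: a new one contributes its charge and, through the
kernel, its own share of the later drift. -/
lemma pointExp_succ (n : ℕ) (z : ℕ → Point) (h : (z n).1 ≤ t) :
    pointExp b ψ d a t (n + 1) z (z n).1
      = pointExp b ψ d a t n z (z n).1 * jumpFactor ψ d a t (z n).2.1 (z n).1 (z n).2.2 := by
  unfold pointExp jumpFactor
  rw [← Complex.exp_add]
  congr 1
  have h1 : ∀ u, pointDrift b ψ d (n + 1) z u = pointDrift b ψ d n z u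
      + ((z n).2.2 : ℂ) * ∑ m, (ψ (u - (z n).1) m (z n).2.1 : ℂ) * d m u := fun u => by
    simp only [pointDrift, pointRate, Finset.sum_range_succ, Finset.mul_sum]
    rw [← Finset.sum_add_distrib]
    refine Finset.sum_congr rfl fun m _ => ?_
    push_cast
    ring
  simp only [h1]
  rw [intervalIntegral.integral_add (hA.intervalIntegrable_pointDrift n z h)
    ((hA.intervalIntegrable_jump _ h).const_mul _), intervalIntegral.integral_const_mul]
  simp only [pointCharge, Finset.sum_range_succ, if_pos h]
  push_cast
  ring

omit hA in
-- An arrival after `t` carries no charge, and at time `t` the drift integral is over a trivial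
-- interval.
lemma pointExp_succ_of_lt (n : ℕ) (z : ℕ → Point) (h : t < (z n).1) :
    pointExp b ψ d a t (n + 1) z t = pointExp b ψ d a t n z t := by
  simp [pointExp, pointCharge, Finset.sum_range_succ, not_le.2 h]

lemma pointRate_nonneg {n : ℕ} {z : ℕ → Point} (hz : ∀ k < n, 0 ≤ (z k).2.2) (m : Fin 2) (u : ℝ) :
    0 ≤ pointRate b ψ n z m u :=
  add_nonneg (hA.baseline_nonneg u) (Finset.sum_nonneg fun k hk =>
    mul_nonneg (hz k (Finset.mem_range.1 hk)) (hA.kernel_nonneg _ _ _))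

lemma pointDrift_re {n : ℕ} {z : ℕ → Point} (hz : ∀ k < n, 0 ≤ (z k).2.2) (u : ℝ) :
    (pointDrift b ψ d n z u).re ≤ 0 := by
  rw [pointDrift, Complex.re_sum]
  refine Finset.sum_nonpos fun m _ => ?_
  rw [Complex.re_ofReal_mul]
  exact mul_nonpos_of_nonneg_of_nonpos (hA.pointRate_nonneg hz m u) (hA.integrand_re m u)

lemma norm_pointExp_le {n : ℕ} {z : ℕ → Point} (hz : ∀ k < n, 0 ≤ (z k).2.2) {s : ℝ}
    (hst : s ≤ t) : ‖pointExp b ψ d a t n z s‖ ≤ 1 := by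
  rw [pointExp, Complex.norm_exp, Real.exp_le_one_iff]
  have hint := hA.intervalIntegrable_pointDrift n z hst
  have h1 : (∫ u in s..t, pointDrift b ψ d n z u).re = ∫ u in s..t, (pointDrift b ψ d n z u).re := by
    simpa using (Complex.reCLM.intervalIntegral_comp_comm hint).symm
  have h2 := intervalIntegral.integral_nonneg (μ := volume)
    (f := fun u => -(pointDrift b ψ d n z u).re) hst
    (fun u _ => by linarith [hA.pointDrift_re hz u])
  rw [intervalIntegral.integral_neg] at h2
  simp only [Complex.add_re, h1, Complex.mul_re, Complex.I_re, Complex.I_im, Complex.ofReal_im,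
    zero_mul, mul_zero, sub_zero, zero_add]
  linarith

lemma norm_jumpFactor_le (l : Fin 2) {s x : ℝ} (hx : 0 ≤ x) (hst : s ≤ t) :
    ‖jumpFactor ψ d a t l s x‖ ≤ 1 := by
  rw [jumpFactor, Complex.norm_exp, Real.exp_le_one_iff]
  have hint := hA.intervalIntegrable_jump l hst
  have h1 : (∫ u in s..t, ∑ m, (ψ (u - s) m l : ℂ) * d m u).re
      = ∫ u in s..t, (∑ m, (ψ (u - s) m l : ℂ) * d m u).re := by
    simpa using (Complex.reCLM.intervalIntegral_comp_comm hint).symm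
  have h2 := intervalIntegral.integral_nonneg (μ := volume)
    (f := fun u => -(∑ m, (ψ (u - s) m l : ℂ) * d m u).re) hst (fun u _ => by
      rw [Complex.re_sum, neg_nonneg]
      refine Finset.sum_nonpos fun m _ => ?_
      rw [Complex.re_ofReal_mul]
      exact mul_nonpos_of_nonneg_of_nonpos (hA.kernel_nonneg _ _ _) (hA.integrand_re m u))
  rw [intervalIntegral.integral_neg, ← h1] at h2
  have h3 : (Complex.I * x * a l + x * ∫ u in s..t, ∑ m, (ψ (u - s) m l : ℂ) * d m u).re
      = x * (∫ u in s..t, ∑ m, (ψ (u - s) m l : ℂ) * d m u).re := by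
    simp [-Fin.sum_univ_two]
  rw [h3]
  exact mul_nonpos_of_nonneg_of_nonpos hx (by linarith)

lemma pointExp_sub {n : ℕ} {z : ℕ → Point} (hz : ∀ k < n, 0 ≤ (z k).2.2) {r s : ℝ}
    (hrs : r ≤ s) (hst : s ≤ t) :
    pointExp b ψ d a t n z s - pointExp b ψ d a t n z r
      = -∫ v in r..s, pointDrift b ψ d n z v * pointExp b ψ d a t n z v := by
  obtain ⟨M, hM⟩ := hA.exists_norm_pointDrift_le n z
  have h := exp_integral_sub ((hA.measurable_pointDrift n).comp
    (measurable_prodMk_left (x := z))) hM (hA.pointDrift_re hz) hrs hst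
  simp only [Function.comp_def] at h
  simp only [pointExp, Complex.exp_add]
  rw [← mul_sub, h, mul_neg, ← intervalIntegral.integral_const_mul]
  congr 2
  ext v
  ring

end IsAdmissible

end Point

/-! ### Mean of the exponential along the arrivals -/

section Martingale

variable {Ω : Type*} {mΩ : MeasurableSpace Ω} {P : Measure Ω} {𝓕 : Filtration ℝ≥0 mΩ} {T : ℝ}
  {μ b : ℝ → ℝ} {φ ψ : ℝ → Matrix (Fin 2) (Fin 2) ℝ} {ν : Measure ℝ} {X : MarkedPoints Ω}
  {d : Fin 2 → ℝ → ℂ} {K : ℝ} {a : Fin 2 → ℝ} {t : ℝ}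

lemma MarkedPoints.history_congr (X : MarkedPoints Ω) (n : ℕ) (ω : Ω) :
    ∀ k < n, X.history (n + 1) ω k = X.history n ω k := fun k hk => by
  simp [history, hk, hk.trans n.lt_succ_self]

lemma MarkedPoints.history_mark_nonneg {X : MarkedPoints Ω} {ω : Ω}
    (h : ∀ n, 0 < X.mark n ω) (n : ℕ) : ∀ k < n, 0 ≤ (X.history n ω k).2.2 := fun k hk => by
  simpa [history, hk, point] using (h k).le

/-- The exponential martingale, stopped at the arrival before the `n`-th one and at `t`. -/
noncomputable def stoppedExp (X : MarkedPoints Ω) (b : ℝ → ℝ)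
    (ψ : ℝ → Matrix (Fin 2) (Fin 2) ℝ) (d : Fin 2 → ℝ → ℂ) (a : Fin 2 → ℝ) (t : ℝ) (n : ℕ)
    (ω : Ω) : ℂ :=
  pointExp b ψ d a t n (X.history n ω) (min t (X.start n ω))

/-- The increment splits into the evolution with frozen history up to `min t (X.time n ω)` and the
jump, present only if arrival `n` occurs by `t`. -/
lemma IsAdmissible.stoppedExp_succ_sub (hA : IsAdmissible b ψ d K) (X : MarkedPoints Ω) (n : ℕ)
    (ω : Ω) :
    stoppedExp X b ψ d a t (n + 1) ω - stoppedExp X b ψ d a t n ω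
      = (pointExp b ψ d a t n (X.history n ω) (min t (X.time n ω))
          - pointExp b ψ d a t n (X.history n ω) (min t (X.start n ω)))
        + if (X.time n ω : ℝ) ≤ t then pointExp b ψ d a t n (X.history n ω) (X.time n ω)
            * (jumpFactor ψ d a t (X.sign n ω) (X.time n ω) (X.mark n ω) - 1) else 0 := by
  have hn : X.history (n + 1) ω n = X.point n ω := by simp [MarkedPoints.history]
  have hc := pointExp_congr (b := b) (ψ := ψ) (d := d) (a := a) (t := t) (X.history_congr n ω)
  have hstart : X.start (n + 1) ω = X.time n ω := rfl
  simp only [stoppedExp, hstart]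
  split_ifs with h
  · have := hA.pointExp_succ (a := a) (t := t) n (X.history (n + 1) ω) (by rw [hn]; exact h)
    rw [hn] at this
    simp only [MarkedPoints.point] at this
    rw [min_eq_right h, this, hc]
    ring
  · have h' := not_le.1 h
    rw [min_eq_left h'.le, IsAdmissible.pointExp_succ_of_lt n _ (by rw [hn]; exact h'), hc]
    ring

lemma IsAdmissible.norm_stoppedExp_le (hA : IsAdmissible b ψ d K) {ω : Ω}
    (hω : ∀ n, 0 < X.mark n ω) (n : ℕ) :
    ‖stoppedExp X b ψ d a t n ω‖ ≤ 1 :=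
  hA.norm_pointExp_le (MarkedPoints.history_mark_nonneg hω n) (min_le_left _ _)

namespace IsMarkedHawkes

variable (hX : IsMarkedHawkes P 𝓕 T μ φ ν X) (hA : IsAdmissible b ψ d K)
include hX

lemma ae_mark_pos (hν_pos : ∀ᵐ x ∂ν, 0 < x) : ∀ᵐ ω ∂P, ∀ n, 0 < X.mark n ω := by
  refine ae_all_iff.2 fun n => ?_
  rw [← hX.mark_law n] at hν_pos
  exact ae_of_ae_map (hX.measurable_mark n).aemeasurable hν_pos

include hA in
lemma measurable_stoppedExp (n : ℕ) : Measurable (stoppedExp X b ψ d a t n) :=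
  hA.measurable_pointExp_comp (measurable_const.min
    (measurable_coe_nnreal_real.comp (hX.measurable_start n))) (hX.measurable_history n) n

variable [IsProbabilityMeasure P] [IsProbabilityMeasure ν]

include hA in
-- By `hint`, averaging `jumpFactor - 1` over the mark gives `d`. Weighted by the rates and summed
-- over types, this is the drift, so the mean jump is minus the mean continuous increment.
lemma integral_jump (hν_pos : ∀ᵐ x ∂ν, 0 < x) (hbμ : ∀ s ∈ Icc 0 T, b s = μ (s / T))
    (hψφ : ∀ s ∈ Icc 0 T, ψ s = φ s) (ht : t ∈ Icc 0 T)
    (hint : ∀ l, ∀ s ∈ Icc 0 t, ∫ x, jumpFactor ψ d a t l s x ∂ν = d l s + 1) (n : ℕ) :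
    ∫ ω, (if (X.time n ω : ℝ) ≤ t then pointExp b ψ d a t n (X.history n ω) (X.time n ω)
            * (jumpFactor ψ d a t (X.sign n ω) (X.time n ω) (X.mark n ω) - 1) else 0) ∂P
      = ∫ ω, (∫ v in (min t (X.start n ω))..(min t (X.time n ω)),
          pointDrift b ψ d n (X.history n ω) v
            * pointExp b ψ d a t n (X.history n ω) v) ∂P := by
  classical
  -- The cut-off at `t` passes from the horizon `T` to `t` and keeps `G` bounded by 2 at the
  -- arrivals, since the exponentials are controlled only up to `t`.
  set G : Fin 2 → ℝ × (ℕ → Point) × ℝ → ℂ := fun m q =>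
    if 0 ≤ q.1 ∧ q.1 ≤ t then pointExp b ψ d a t n q.2.1 q.1
      * (jumpFactor ψ d a t m q.1 q.2.2 - 1) else 0 with hG
  have hGm : ∀ m, Measurable (G m) := fun m => by
    refine Measurable.ite ((measurableSet_le measurable_const measurable_fst).inter
      (measurableSet_le measurable_fst measurable_const)) (Measurable.mul ?_ ?_) measurable_const
    · exact hA.measurable_pointExp_comp measurable_fst measurable_snd.fst n
    · exact (hA.measurable_jumpFactor_comp measurable_fst measurable_snd.snd m).sub_const 1
  have hmark := hX.ae_mark_pos hν_pos
  have hGK : ∀ m, ∀ᵐ ω ∂P, ‖G m (X.time n ω, X.history n ω, X.mark n ω)‖ ≤ 2 := fun m => by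
    filter_upwards [hmark] with ω hω
    simp only [hG]
    split_ifs with h
    · rw [norm_mul]
      have h1 := hA.norm_pointExp_le (a := a) (MarkedPoints.history_mark_nonneg hω n) h.2
      have h2 : ‖jumpFactor ψ d a t m (X.time n ω) (X.mark n ω) - 1‖ ≤ 2 := by
        refine (norm_sub_le _ _).trans ?_
        have := hA.norm_jumpFactor_le (a := a) m (hω n).le h.2
        rw [norm_one]
        linarith
      nlinarith [norm_nonneg (pointExp b ψ d a t n (X.history n ω) (X.time n ω)),
        norm_nonneg (jumpFactor ψ d a t m (X.time n ω) (X.mark n ω) - 1)]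
    · simp
  have hstep := fun m => hX.integral_step hA.measurable_baseline hA.measurable_kernel hbμ hψφ n m
    (hGm m) (hGK m)
  have hE : ∀ m, MeasurableSet {ω | (X.time n ω : ℝ) ≤ T ∧ X.sign n ω = m} := fun m =>
    (measurableSet_le (measurable_coe_nnreal_real.comp (hX.measurable_time n))
      measurable_const).inter (measurableSet_eq_fun (hX.measurable_sign n) measurable_const)
  have hleft : ∫ ω, (if (X.time n ω : ℝ) ≤ t then
      pointExp b ψ d a t n (X.history n ω) (X.time n ω)
            * (jumpFactor ψ d a t (X.sign n ω) (X.time n ω) (X.mark n ω) - 1) else 0) ∂P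
      = ∑ m, ∫ ω in {ω | (X.time n ω : ℝ) ≤ T ∧ X.sign n ω = m},
          G m (X.time n ω, X.history n ω, X.mark n ω) ∂P := by
    simp_rw [← integral_indicator (hE _)]
    rw [← integral_finsetSum]
    · refine integral_congr_ae (ae_of_all _ fun ω => ?_)
      simp only [indicator_apply, mem_ofPred_eq, hG, NNReal.coe_nonneg, true_and]
      by_cases h : (X.time n ω : ℝ) ≤ t
      · simp only [h, h.trans ht.2, true_and, if_true]
        rw [Finset.sum_ite_eq, if_pos (Finset.mem_univ _)]
      · simp [h]
    · intro m _
      refine (Integrable.of_bound ?_ 2 (hGK m)).indicator (hE m)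
      exact ((hGm m).comp ((measurable_coe_nnreal_real.comp (hX.measurable_time n)).prodMk
        ((hX.measurable_history n).prodMk (hX.measurable_mark n)))).aestronglyMeasurable
  rw [hleft, Finset.sum_congr rfl fun m _ => (hstep m).2,
    ← integral_finsetSum _ fun m _ => (hstep m).1,
    integral_prod _ (integrable_finsetSum _ fun m _ => (hstep m).1)]
  refine integral_congr_ae ?_
  filter_upwards [hmark] with ω hω
  have hpos := MarkedPoints.history_mark_nonneg hω n
  have hle : min t (X.start n ω : ℝ) ≤ min t (X.time n ω : ℝ) := min_le_min_left _
    (NNReal.coe_le_coe.2 (MarkedPoints.start_le_time (hX.time_strictMono ω) n))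
  rw [intervalIntegral.integral_of_le hle]
  have hsub : Ioc (min t (X.start n ω : ℝ)) (min t (X.time n ω)) ⊆ Icc 0 T := fun s hs =>
    ⟨(le_min ht.1 (NNReal.coe_nonneg _)).trans hs.1.le, hs.2.trans ((min_le_left _ _).trans ht.2)⟩
  rw [← inter_eq_self_of_subset_right hsub, ← setIntegral_indicator measurableSet_Ioc]
  refine setIntegral_congr_fun measurableSet_Icc fun s hs => ?_
  simp only [indicator_apply]
  have hiff : s ∈ Ioc (min t (X.start n ω : ℝ)) (min t (X.time n ω))
      ↔ ((X.start n ω : ℝ) < s ∧ s ≤ X.time n ω) ∧ (0 ≤ s ∧ s ≤ t) := by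
    rw [mem_Ioc, min_lt_iff, le_min_iff]
    constructor
    · rintro ⟨h1, h2, h3⟩
      rcases h1 with h1 | h1
      · exact absurd h2 (not_le.2 h1)
      · exact ⟨⟨h1, h3⟩, hs.1, h2⟩
    · rintro ⟨⟨h1, h2⟩, h3, h4⟩
      exact ⟨Or.inr h1, h4, h2⟩
  by_cases hin : (X.start n ω : ℝ) < s ∧ s ≤ X.time n ω
  · by_cases hst : 0 ≤ s ∧ s ≤ t
    · rw [if_pos (hiff.2 ⟨hin, hst⟩), pointDrift, Finset.sum_mul]
      refine Finset.sum_congr rfl fun m _ => ?_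
      simp only [hG, if_pos hst, stepDensity, if_pos hin]
      have hF : Integrable (fun x => jumpFactor ψ d a t m s x) ν := by
        refine Integrable.of_bound (hA.measurable_jumpFactor_comp measurable_const
          measurable_id m).aestronglyMeasurable 1 ?_
        filter_upwards [hν_pos] with x hx
        exact hA.norm_jumpFactor_le m hx.le hst.2
      rw [integral_const_mul, integral_sub hF (integrable_const _), hint m s hst,
        ENNReal.toReal_ofReal (hA.pointRate_nonneg hpos m s)]
      simp only [integral_const, probReal_univ, one_smul, add_sub_cancel_right,
        Complex.real_smul]
      ring
    · rw [if_neg fun h => hst (hiff.1 h).2]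
      refine Finset.sum_eq_zero fun m _ => ?_
      simp only [hG, if_neg hst, integral_zero, smul_zero]
  · rw [if_neg fun h => hin (hiff.1 h).1]
    refine Finset.sum_eq_zero fun m _ => ?_
    simp only [stepDensity, if_neg hin, ENNReal.toReal_zero, zero_smul]

include hA in
lemma integral_stoppedExp (hν_pos : ∀ᵐ x ∂ν, 0 < x) (hbμ : ∀ s ∈ Icc 0 T, b s = μ (s / T))
    (hψφ : ∀ s ∈ Icc 0 T, ψ s = φ s) (ht : t ∈ Icc 0 T)
    (hint : ∀ l, ∀ s ∈ Icc 0 t, ∫ x, jumpFactor ψ d a t l s x ∂ν = d l s + 1) (n : ℕ) :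
    ∫ ω, stoppedExp X b ψ d a t n ω ∂P = Complex.exp (∫ u in (0 : ℝ)..t, ∑ m, (b u : ℂ) * d m u) := by
  have hmark := hX.ae_mark_pos hν_pos
  have hintV : ∀ n, Integrable (stoppedExp X b ψ d a t n) P := fun n =>
    Integrable.of_bound (hX.measurable_stoppedExp hA n).aestronglyMeasurable 1 (by
      filter_upwards [hmark] with ω hω using hA.norm_stoppedExp_le hω n)
  induction n with
  | zero =>
    have : ∀ ω, stoppedExp X b ψ d a t 0 ω
        = Complex.exp (∫ u in (0 : ℝ)..t, ∑ m, (b u : ℂ) * d m u) := fun ω => by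
      have h0 : min t ((X.start 0 ω : ℝ≥0) : ℝ) = 0 := by
        simp [MarkedPoints.start, ht.1]
      simp only [stoppedExp, h0, pointExp, pointCharge, pointDrift, pointRate, Finset.range_zero,
        Finset.sum_empty, Complex.ofReal_zero, mul_zero, zero_add, add_zero]
    simp only [this, integral_const, probReal_univ, one_smul]
  | succ n ih =>
    rw [← ih, ← sub_eq_zero, ← integral_sub (hintV _) (hintV _)]
    simp only [hA.stoppedExp_succ_sub X n]
    have hm := hX.measurable_history n
    have hW : Integrable (fun ω => pointExp b ψ d a t n (X.history n ω) (min t (X.time n ω))) P := by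
      refine Integrable.of_bound (hA.measurable_pointExp_comp (measurable_const.min
        (measurable_coe_nnreal_real.comp (hX.measurable_time n))) hm n).aestronglyMeasurable 1 ?_
      filter_upwards [hmark] with ω hω
      exact hA.norm_pointExp_le (MarkedPoints.history_mark_nonneg hω n) (min_le_left _ _)
    have hdiff : Integrable (fun ω => pointExp b ψ d a t n (X.history n ω) (min t (X.time n ω))
        - pointExp b ψ d a t n (X.history n ω) (min t (X.start n ω))) P := hW.sub (hintV n)
    -- The jump term is a difference of bounded terms already known to be integrable.
    have hjump : Integrable (fun ω => if (X.time n ω : ℝ) ≤ t then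
        pointExp b ψ d a t n (X.history n ω) (X.time n ω)
            * (jumpFactor ψ d a t (X.sign n ω) (X.time n ω) (X.mark n ω) - 1) else 0) P := by
      have h := ((hintV (n + 1)).sub (hintV n)).sub hdiff
      refine h.congr (ae_of_all _ fun ω => ?_)
      simp only [Pi.sub_apply]
      rw [hA.stoppedExp_succ_sub X n]
      exact add_sub_cancel_left _ _
    rw [integral_add hdiff hjump, hX.integral_jump hA hν_pos hbμ hψφ ht hint n]
    have : ∫ ω, (pointExp b ψ d a t n (X.history n ω) (min t (X.time n ω))
          - pointExp b ψ d a t n (X.history n ω) (min t (X.start n ω))) ∂P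
        = -∫ ω, (∫ v in (min t (X.start n ω))..(min t (X.time n ω)),
          pointDrift b ψ d n (X.history n ω) v
            * pointExp b ψ d a t n (X.history n ω) v) ∂P := by
      rw [← integral_neg]
      refine integral_congr_ae ?_
      filter_upwards [hmark] with ω hω
      exact hA.pointExp_sub (MarkedPoints.history_mark_nonneg hω n) (min_le_min_left _
        (NNReal.coe_le_coe.2 (MarkedPoints.start_le_time (hX.time_strictMono ω) n)))
        (min_le_left _ _)
    refine (congrArg (· + _) this).trans ?_
    exact neg_add_cancel _

omit [IsProbabilityMeasure P] [IsProbabilityMeasure ν] in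
lemma tendsto_stoppedExp (ht : t ∈ Icc 0 T) : ∀ᵐ ω ∂P,
    Tendsto (fun n => stoppedExp X b ψ d a t n ω) atTop (𝓝
      (Complex.exp (Complex.I * a 0 * X.jumps 0 t ω + Complex.I * a 1 * X.jumps 1 t ω))) := by
  filter_upwards [hX.locallyFinite] with ω hfin
  obtain ⟨N, hN⟩ := hfin.bddAbove
  have hlarge : ∀ k, N < k → t < X.time k ω := fun k hk => by
    by_contra h
    exact absurd (hN ((not_lt.1 h).trans ht.2 : (X.time k ω : ℝ) ≤ T)) (not_le.2 hk)
  refine tendsto_const_nhds.congr' ?_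
  -- `X.start n` is the time of arrival `n - 1`, so `n ≥ N + 2` makes that index exceed `N`. From
  -- then on the sequence is constant.
  filter_upwards [eventually_ge_atTop (N + 2)] with n hn
  have hst : t < X.start n ω := by
    obtain ⟨k, rfl⟩ : ∃ k, n = k + 1 := ⟨n - 1, by omega⟩
    exact hlarge k (by omega)
  have hj : ∀ m, X.jumps m t ω = ∑ k ∈ Finset.range n,
      if (X.time k ω : ℝ) ≤ t ∧ X.sign k ω = m then X.mark k ω else 0 := fun m => by
    unfold MarkedPoints.jumps MarkedPoints.integral
    rw [tsum_eq_sum (s := Finset.range n)]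
    · simp only [mul_one]
    · intro k hk
      rw [if_neg]
      rintro ⟨h, -⟩
      have := Finset.mem_range.not.1 hk
      exact absurd h (not_le.2 (hlarge k (by omega)))
  have hc : pointCharge a t n (X.history n ω) = a 0 * X.jumps 0 t ω + a 1 * X.jumps 1 t ω := by
    rw [hj, hj, Finset.mul_sum, Finset.mul_sum, ← Finset.sum_add_distrib]
    refine Finset.sum_congr rfl fun k hk => ?_
    simp only [MarkedPoints.history, if_pos (Finset.mem_range.1 hk), MarkedPoints.point]
    by_cases h : (X.time k ω : ℝ) ≤ t
    · have h01 : X.sign k ω = 0 ∨ X.sign k ω = 1 := by omega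
      rcases h01 with h0 | h0 <;> simp [h, h0, mul_comm]
    · simp [h]
  rw [stoppedExp, min_eq_left hst.le, pointExp, intervalIntegral.integral_same, hc]
  push_cast
  ring_nf

include hA in
theorem integral_exp_jumps (hν_pos : ∀ᵐ x ∂ν, 0 < x) (hbμ : ∀ s ∈ Icc 0 T, b s = μ (s / T))
    (hψφ : ∀ s ∈ Icc 0 T, ψ s = φ s) (ht : t ∈ Icc 0 T)
    (hint : ∀ l, ∀ s ∈ Icc 0 t, ∫ x, jumpFactor ψ d a t l s x ∂ν = d l s + 1) :
    ∫ ω, Complex.exp (Complex.I * a 0 * X.jumps 0 t ω + Complex.I * a 1 * X.jumps 1 t ω) ∂P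
      = Complex.exp (∫ u in (0 : ℝ)..t, ∑ m, (b u : ℂ) * d m u) := by
  have hlim := tendsto_integral_of_dominated_convergence (fun _ => (1 : ℝ))
    (fun n => (hX.measurable_stoppedExp hA (a := a) (t := t) n).aestronglyMeasurable)
    (integrable_const _)
    (fun n => by
      filter_upwards [hX.ae_mark_pos hν_pos] with ω hω using hA.norm_stoppedExp_le hω n)
    (hX.tendsto_stoppedExp ht)
  simp only [hX.integral_stoppedExp hA hν_pos hbμ hψφ ht hint] at hlim
  exact (tendsto_nhds_unique hlim tendsto_const_nhds)

end IsMarkedHawkes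

end Martingale

/-! ### Choice of the data and conclusion -/

/-- The data of the problem, set to zero outside the time horizon, are admissible. -/
lemma exists_isAdmissible {T : ℝ} (hT : 0 < T) {μ : ℝ → ℝ} (hμ_mono : MonotoneOn μ (Icc 0 1))
    (hμ_nonneg : ∀ u ∈ Icc (0 : ℝ) 1, 0 ≤ μ u) {φ : ℝ → Matrix (Fin 2) (Fin 2) ℝ}
    (hφ_meas : ∀ i j, Measurable fun u => φ u i j)
    (hφ_nonneg : ∀ u, 0 ≤ u → ∀ i j, 0 ≤ φ u i j) {B : ℝ}
    (hφB : ∀ u ∈ Icc 0 T, ∀ i j, φ u i j ≤ B) {C : ℝ → Fin 2 → ℂ} (hC : Measurable C)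
    (hC1 : ∀ t ∈ Icc 0 T, ∀ m, ‖C t m‖ ≤ 1) {t : ℝ} (ht : t ∈ Icc 0 T) :
    ∃ (b : ℝ → ℝ) (ψ : ℝ → Matrix (Fin 2) (Fin 2) ℝ) (d : Fin 2 → ℝ → ℂ) (K : ℝ),
      IsAdmissible b ψ d K ∧ (∀ s ∈ Icc 0 T, b s = μ (s / T)) ∧ (∀ s ∈ Icc 0 T, ψ s = φ s) ∧
      ∀ s ∈ Icc 0 t, ∀ m, d m s = C (t - s) m - 1 := by
  classical
  have hunit : ∀ s ∈ Icc 0 T, s / T ∈ Icc (0 : ℝ) 1 := fun s hs =>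
    ⟨div_nonneg hs.1 hT.le, (div_le_one hT).2 hs.2⟩
  -- A monotone extension to the line supplies measurability of the baseline, which is only known to
  -- be monotone on `[0, 1]`.
  obtain ⟨g, hg, hgμ⟩ := hμ_mono.exists_monotone_extension
    ⟨0, by rintro _ ⟨u, hu, rfl⟩; exact hμ_nonneg u hu⟩
    ⟨μ 1, by rintro _ ⟨u, hu, rfl⟩; exact hμ_mono hu ⟨zero_le_one, le_rfl⟩ hu.2⟩
  have hB : 0 ≤ B := (hφ_nonneg 0 le_rfl 0 0).trans (hφB 0 ⟨le_rfl, hT.le⟩ 0 0)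
  have hμ1 : 0 ≤ μ 1 := hμ_nonneg 1 ⟨zero_le_one, le_rfl⟩
  have hsub : ∀ u ∈ Icc 0 t, t - u ∈ Icc 0 T := fun u hu =>
    ⟨by linarith [hu.2], by linarith [hu.1, ht.2]⟩
  -- In the constant, `μ 1` bounds the baseline, `B` the kernel, and 2 bounds `‖C - 1‖` on the unit
  -- disc.
  refine ⟨fun s => if s ∈ Icc 0 T then g (s / T) else 0,
    fun s i j => if s ∈ Icc 0 T then φ s i j else 0,
    fun m u => if u ∈ Icc 0 t then C (t - u) m - 1 else 0, μ 1 + B + 2,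
    ⟨?_, fun i j => ?_, fun m => ?_, fun u => ?_, fun u => ?_, fun u i j => ?_, fun u i j => ?_,
      fun m u => ?_, fun m u => ?_⟩, fun s hs => ?_, fun s hs => ?_, fun s hs m => ?_⟩
  · exact Measurable.ite measurableSet_Icc (hg.measurable.comp (measurable_id.div_const T))
      measurable_const
  · exact Measurable.ite measurableSet_Icc (hφ_meas i j) measurable_const
  · exact Measurable.ite measurableSet_Icc (((measurable_pi_iff.1 hC m).comp
      (measurable_const.sub measurable_id)).sub_const 1) measurable_const
  · split_ifs with h
    · rw [← hgμ (hunit u h)]; exact hμ_nonneg _ (hunit u h)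
    · exact le_rfl
  · split_ifs with h
    · rw [← hgμ (hunit u h)]
      linarith [hμ_mono (hunit u h) ⟨zero_le_one, le_rfl⟩ (hunit u h).2]
    · positivity
  · split_ifs with h
    · exact hφ_nonneg u h.1 i j
    · exact le_rfl
  · split_ifs with h
    · linarith [hφB u h i j]
    · positivity
  · split_ifs with h
    · rw [Complex.sub_re, Complex.one_re]
      linarith [Complex.re_le_norm (C (t - u) m), hC1 _ (hsub u h) m]
    · simp
  · split_ifs with h
    · refine (norm_sub_le _ _).trans ?_
      rw [norm_one]
      linarith [hC1 _ (hsub u h) m]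
    · rw [norm_zero]; positivity
  · simp only [if_pos hs, hgμ (hunit s hs)]
  · ext i j
    simp only [if_pos hs]
  · simp only [if_pos hs]

/-- The substitution `u = v + s` turns the effect of an arrival at `s` into the mark factor with
time `t - s` to go. This is how the fixed-point equation yields the mean of the jump. -/
lemma jumpFactor_eq_markFactor {T t s : ℝ} {φ ψ : ℝ → Matrix (Fin 2) (Fin 2) ℝ}
    {C : ℝ → Fin 2 → ℂ} {d : Fin 2 → ℝ → ℂ} (a : Fin 2 → ℝ)
    (hψ : ∀ s ∈ Icc 0 T, ψ s = φ s) (hd : ∀ s ∈ Icc 0 t, ∀ m, d m s = C (t - s) m - 1)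
    (ht : t ∈ Icc 0 T) (hs : s ∈ Icc 0 t) (l : Fin 2) (x : ℝ) :
    jumpFactor ψ d a t l s x = markFactor φ a C l (t - s) x := by
  have h1 : ∫ u in s..t, ∑ m, (ψ (u - s) m l : ℂ) * d m u = kernelConv φ C l (t - s) := by
    have h2 := intervalIntegral.integral_comp_sub_right (a := s) (b := t)
      (fun v => ∑ m, (ψ v m l : ℂ) * d m (v + s)) s
    simp only [sub_add_cancel, sub_self] at h2
    rw [h2]
    refine intervalIntegral.integral_congr fun v hv => ?_
    rw [uIcc_of_le (sub_nonneg.2 hs.2)] at hv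
    refine Finset.sum_congr rfl fun m _ => ?_
    rw [hψ v ⟨hv.1, by linarith [hv.2, hs.1, ht.2]⟩,
      hd (v + s) ⟨add_nonneg hv.1 hs.1, by linarith [hv.2]⟩, sub_sub, add_comm s v]
  rw [jumpFactor, h1, markFactor_eq]

end MarkedHawkes

theorem proposition6p1 {Ω : Type*} {mΩ : MeasurableSpace Ω} (P : Measure Ω)
    [IsProbabilityMeasure P] (𝓕 : Filtration ℝ≥0 mΩ)
    (T : ℝ) (hT : 0 < T)
    (μ : ℝ → ℝ) (hμ_mono : MonotoneOn μ (Icc 0 1)) (hμ_nonneg : ∀ u ∈ Icc (0 : ℝ) 1, 0 ≤ μ u)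
    (φ : ℝ → Matrix (Fin 2) (Fin 2) ℝ)
    (hφ_meas : ∀ i j, Measurable fun u => φ u i j)
    (hφ_nonneg : ∀ u, 0 ≤ u → ∀ i j, 0 ≤ φ u i j)
    (hφ_bdd : ∀ R : ℝ, ∃ B : ℝ, ∀ u ∈ Icc 0 R, ∀ i j, φ u i j ≤ B)
    (hφ_int : ∀ i j, IntegrableOn (fun u => φ u i j) (Ici 0))
    (ν : Measure ℝ) [IsProbabilityMeasure ν] (hν_pos : ∀ᵐ x ∂ν, 0 < x)
    (hν_sq : MemLp (fun x : ℝ => x) 2 ν)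
    (hK : spectralRadius ℂ ((MarkedHawkes.branchingMatrix φ ν).map (algebraMap ℝ ℂ)) < 1)
    (X : MarkedHawkes.MarkedPoints Ω)
    (hX : MarkedHawkes.IsMarkedHawkes P 𝓕 T μ φ ν X) (a : Fin 2 → ℝ) :
    (∃ C, MarkedHawkes.IsSolution T φ ν a C) ∧
    ∀ C, MarkedHawkes.IsSolution T φ ν a C → ∀ t ∈ Icc 0 T,
      ∫ ω, Complex.exp (Complex.I * a 0 * X.jumps 0 t ω + Complex.I * a 1 * X.jumps 1 t ω) ∂P
        = Complex.exp (∫ s in (0 : ℝ)..t, (μ (s / T) : ℂ) * ∑ m, (C (t - s) m - 1)) := by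
  obtain ⟨B, hφB⟩ := hφ_bdd T
  refine ⟨MarkedHawkes.exists_isSolution hφ_meas hφ_nonneg hφB hν_pos
    (hν_sq.integrable one_le_two) a, fun C hC t ht => ?_⟩
  have hC1 := hC.norm_le_one hφ_meas hφ_nonneg hφB hν_pos
  obtain ⟨b, ψ, d, K, hA, hbμ, hψφ, hd⟩ := MarkedHawkes.exists_isAdmissible hT hμ_mono hμ_nonneg
    hφ_meas hφ_nonneg hφB hC.measurable hC1 ht
  rw [hX.integral_exp_jumps hA hν_pos hbμ hψφ ht fun l s hs => ?_]
  · congr 1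
    refine intervalIntegral.integral_congr fun s hs => ?_
    rw [uIcc_of_le ht.1] at hs
    simp only [hbμ s ⟨hs.1, hs.2.trans ht.2⟩, hd s hs, Finset.mul_sum]
  · simp only [MarkedHawkes.jumpFactor_eq_markFactor a hψφ hd ht hs]
    rw [hd s hs, sub_add_cancel]
    exact (hC.eq (t - s) ⟨sub_nonneg.2 hs.2, by linarith [hs.1, ht.2]⟩ l).symm
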